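/- Let $\lambda,a$ be real with $a>0$, and assume either $-1<\lambda<0$, or $\lambda>0$ and $a>\tfrac12(1+\lambda)\lambda^{(1-\lambda)/(1+\lambda)}$. For real $\mu,z$ put $$W_{\lambda,\mu}(z)=\sum_{n\ge 0}\frac{z^n}{n!\,\Gamma(\lambda n+\mu)}$$ (with $1/\Gamma=0$ at the poles of $\Gamma$); this series converges for all real $\mu,z$. For $x>0$ put $\mathcal W^-_{\lambda,\nu}(x)=(x/2)^\nu\,W_{\lambda,\nu+1}\bigl(-(x/2)^{\lambda+1}\bigr)$. Let $h(u)=\tfrac12(e^u-e^{-\lambda u})-au$. The saddle point equation $h'(u)=0$, that is $e^u+\lambda e^{-\lambda u}=2a$, has exactly one real root if $\lambda<0$ and exactly two real roots if $\lambda>0$. Let $u_0$ be its only, respectively its larger, real root and write $h_0^{(n)}=h^{(n)}(u_0)$, $\mathbf h_n=h_0^{(n)}/h_0''$. Then $h_0''>0$ and $$h_0^{(n)}=\tfrac12\bigl(1-(-\lambda)^{n-1}\bigr)e^{u_0}+a(-\lambda)^{n-1}\qquad(n\ge 2).$$ There are a function $u=u(w)$, analytic at $w=0$, with $$-\tfrac12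 w^2=h(u)-h(u_0),\qquad u-u_0=\frac{w}{\sqrt{-h_0''}}+O(w^2)\qquad(w\to0),\qquad \frac1{\sqrt{-h_0''}}:=\frac{i}{\sqrt{h_0''}},$$ and real numbers $A_0,A_1,A_2,\dots$ such that the even part of its derivative is, for $w$ near $0$, $$\frac{u'(w)+u'(-w)}2=\frac1{\sqrt{-h_0''}}\sum_{k\ge0}(-1)^kA_kw^{2k}.$$ Moreover $A_0=1$, $$A_1=\frac{5\mathbf h_3^2-3\mathbf h_4}{24h_0''},\qquad A_2=\frac{385\mathbf h_3^4-630\mathbf h_3^2\mathbf h_4+105\mathbf h_4^2+168\mathbf h_3\mathbf h_5-24\mathbf h_6}{3456\,h_0''^2},$$ $$\begin{aligned}A_3=\frac{1}{6220800\,h_0''^3}\bigl(&425425\mathbf h_3^6-1126125\mathbf h_3^4\mathbf h_4+675675\mathbf h_3^2\mathbf h_4^2-51975\mathbf h_4^3+360360\mathbf h_3^3\mathbf h_5\\&-249480\mathbf h_3\mathbf h_4\mathbf h_5+13608\mathbf h_5^2-83160\mathbf h_3^2\mathbf h_6+22680\mathbf h_4\mathbf h_6+12960\mathbf h_3\mathbf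 h_7-1080\mathbf h_8\bigr),\end{aligned}$$ and, with $\nu=ax$ and $(\tfrac12)_k=\tfrac12(\tfrac12+1)\cdots(\tfrac12+k-1)$, $$\mathcal W^-_{\lambda,\nu}(x)\sim\frac{e^{xh(u_0)}}{\sqrt{2\pi xh_0''}}\sum_{k\ge0}\frac{(-1)^k(\frac12)_kA_k}{(x/2)^k}\qquad(x\to+\infty)$$ as a Poincaré asymptotic expansion: for every $N\ge0$, $$\mathcal W^-_{\lambda,ax}(x)=\frac{e^{xh(u_0)}}{\sqrt{2\pi xh_0''}}\left(\sum_{k=0}^{N-1}\frac{(-1)^k(\frac12)_kA_k}{(x/2)^k}+O(x^{-N})\right)\qquad(x\to+\infty).$$ -/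

import Mathlib

open Filter Topology Asymptotics

noncomputable section

/-- The Wright function `W_{λ,μ}(z) = ∑ zⁿ / (n! Γ(λ n + μ))` for real parameters and real argument.
At a pole of `Γ` Mathlib puts `Gamma = 0`, so such a term is `0`, as it is with the usual
convention that the reciprocal Gamma function is entire. -/
def wrightW (lam mu z : ℝ) : ℝ :=
  ∑' n : ℕ, z ^ n / ((n.factorial : ℝ) * Real.Gamma (lam * n + mu))

/-- `𝒲⁻_{λ,ν}(x) = (x/2)^ν W_{λ,ν+1}(-(x/2)^{λ+1})`, for `x > 0`. -/
def wrightMinus (lam nu x : ℝ) : ℝ :=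
  (x / 2) ^ nu * wrightW lam (nu + 1) (-((x / 2) ^ (lam + 1)))

/-- The phase function `h(u) = (e^u - e^{-λu})/2 - a u` on the real line. -/
def phase (lam a u : ℝ) : ℝ :=
  (Real.exp u - Real.exp (-lam * u)) / 2 - a * u

/-- The same phase function on the complex plane. -/
def phaseC (lam a : ℝ) (u : ℂ) : ℂ :=
  (Complex.exp u - Complex.exp (-(lam : ℂ) * u)) / 2 - (a : ℂ) * u

/-- The real solutions `u` of the saddle point equation `e^u + λ e^{-λu} = 2a`. -/
def realSaddles (lam a : ℝ) : Set ℝ :=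
  {u : ℝ | Real.exp u + lam * Real.exp (-lam * u) = 2 * a}

/-- The derivative `h₀^{(n)} = h^{(n)}(u₀)`. -/
def phaseDeriv (lam a u0 : ℝ) (n : ℕ) : ℝ :=
  iteratedDeriv n (phase lam a) u0

/-- The normalized derivative `h₀^{(n)} / h₀''`. -/
def phaseRatio (lam a u0 : ℝ) (n : ℕ) : ℝ :=
  phaseDeriv lam a u0 n / phaseDeriv lam a u0 2

/-- The value `1/√(-h₀'') = i/√(h₀'')`, for the branch `√(-h₀'') = -i √(h₀'')`. -/
def invSqrtNeg (lam a u0 : ℝ) : ℂ :=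
  Complex.I / ((Real.sqrt (phaseDeriv lam a u0 2) : ℝ) : ℂ)

/-- `u = u(w)` is the local inversion at the saddle point `u₀` of the quadratic normal form
`-w²/2 = h(u) - h(u₀)`: it is analytic at `w = 0` and `u - u₀ = w/√(-h₀'') + O(w²)`. -/
structure IsLocalReversion (lam a u0 : ℝ) (u : ℂ → ℂ) : Prop where
  analyticAt : AnalyticAt ℂ u 0
  map_zero : u 0 = (u0 : ℂ)
  deriv_zero : deriv u 0 = invSqrtNeg lam a u0
  normal_form : ∀ᶠ w in 𝓝 (0 : ℂ),
    -(w ^ 2) / 2 = phaseC lam a (u w) - phaseC lam a (u0 : ℂ)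

/-- `A` is the sequence of coefficients of the even part of `du/dw`, that is
`(u'(w) + u'(-w))/2 = 1/√(-h₀'') ∑ (-1)^k A_k w^{2k}` near `w = 0`. -/
def IsReversionCoeffs (lam a u0 : ℝ) (A : ℕ → ℝ) : Prop :=
  ∃ u : ℂ → ℂ, IsLocalReversion lam a u0 u ∧
    ∀ᶠ w in 𝓝 (0 : ℂ),
      HasSum (fun k : ℕ => invSqrtNeg lam a u0 * ((-1) ^ k * (A k : ℂ) * w ^ (2 * k)))
        ((deriv u w + deriv u (-w)) / 2)

/-- The factor `e^{x h(u₀)} / √(2π x h₀'')` in front of the expansion. -/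
def saddlePrefactor (lam a u0 x : ℝ) : ℝ :=
  Real.exp (x * phase lam a u0) / Real.sqrt (2 * Real.pi * x * phaseDeriv lam a u0 2)

/-- The Pochhammer symbol `(c)_k = c (c+1) ⋯ (c+k-1)`. -/
def poch (c : ℝ) (k : ℕ) : ℝ := (ascPochhammer ℝ k).eval c

end

noncomputable section

/-! This is the saddle point method on a vertical line, preceded by the integral representation that
it needs.

Hankel's formula writes `1/Γ(s)` as an integral of `e^t t^(-s)`. Inserted in the series and summed
under the integral sign, it gives `W_{λ,μ}(z)` as an integral of `exp (t + z t^(-λ)) t^(-μ)`. The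
exchange is justified on a ray leaning to the left, where `e^t` decays exponentially and dominates
`exp (|z| |t|^(-λ))` because `-λ < 1`. For `z ≤ 0` and `μ ≥ 2` the ray can then be turned back to a
vertical line (`wrightKernel_vertical`). With `t = (x/2) e^u`, `z = -(x/2)^(λ+1)` and `ν = a x`, the
integrand becomes `e^(x h(u))` and the line through `(x/2) e^(u₀)` becomes `u = u₀ + log (1 + iτ)`
(`wrightMinus_eq_integral`).

On this line `Re h` is even in `τ` and strictly decreasing in `|τ|`. In the angle `θ = arctan τ`
this reduces to `sin ((1+λ)θ) ≤ (1+λ) sin θ` together with `h''(u₀) > 0` when `λ > 0`, and to the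
signs of the terms when `λ < 0` (`strictAntiOn_phaseDecay`). The part with `|τ| ≥ δ` is therefore
exponentially small, relative to `e^(x h(u₀))`.

Near `τ = 0` the reversion `w ↦ u(w)` turns the phase into `-w²/2` and the path into a curve tangent
to the real axis. Its ends can be moved to `±η` at exponentially small cost (`path_expansion`). Only
the even part of `u'` survives on `[-η, η]`, and its power series integrates term by term against
the Gaussian (`gaussian_expansion`). The reversion comes from an analytic square root of the phase
(`exists_sqrt_reversion`), and `A₁, A₂, A₃` from comparing Taylor coefficients (`reversion_coeffs`).
-/

/-! ### Laplace transform of a power -/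

theorem cpow_sub_one_mul_self {z : ℂ} (hz : z ≠ 0) (s : ℂ) : z ^ (s - 1) * z = z ^ s := by
  rw [Complex.cpow_sub _ _ hz, Complex.cpow_one, div_mul_cancel₀ _ hz]

open MeasureTheory Set in
theorem integrableOn_rpow_mul_exp_neg_mul {s c : ℝ} (hs : 0 < s) (hc : 0 < c) :
    IntegrableOn (fun t : ℝ => t ^ (s - 1) * Real.exp (-(c * t))) (Ioi 0) := by
  have h := integrableOn_rpow_mul_exp_neg_mul_rpow (s := s - 1) (p := 1) (b := c)
    (by linarith) one_pos hc
  simpa [neg_mul] using h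

theorem norm_laplaceKernel {s c y t : ℝ} (ht : 0 < t) :
    ‖(t : ℂ) ^ ((s : ℂ) - 1) * Complex.exp (-((c + y * Complex.I) * t))‖ =
      t ^ (s - 1) * Real.exp (-(c * t)) := by
  rw [norm_mul, Complex.norm_exp, Complex.norm_cpow_eq_rpow_re_of_pos ht]
  simp

open MeasureTheory Set in
theorem aestronglyMeasurable_laplaceKernel (s c y : ℝ) :
    AEStronglyMeasurable (fun t : ℝ => (t : ℂ) ^ ((s : ℂ) - 1) *
      Complex.exp (-((c + y * Complex.I) * t))) (volume.restrict (Ioi 0)) := by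
  refine ContinuousOn.aestronglyMeasurable (fun t ht => ?_) measurableSet_Ioi
  refine ContinuousAt.continuousWithinAt ?_
  have : (t : ℂ) ∈ Complex.slitPlane := Complex.ofReal_mem_slitPlane.2 ht
  fun_prop (disch := assumption)

open MeasureTheory Set in
theorem integrableOn_laplaceKernel {s c : ℝ} (hs : 0 < s) (hc : 0 < c) (y : ℝ) :
    IntegrableOn (fun t : ℝ => (t : ℂ) ^ ((s : ℂ) - 1) *
      Complex.exp (-((c + y * Complex.I) * t))) (Ioi 0) := by
  refine Integrable.mono' (integrableOn_rpow_mul_exp_neg_mul hs hc)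
    (aestronglyMeasurable_laplaceKernel s c y) ?_
  filter_upwards [ae_restrict_mem measurableSet_Ioi] with t ht
  exact (norm_laplaceKernel ht).le

open MeasureTheory Set in
-- Integration by parts: `t^s e^(-rt)` vanishes at both ends, so its derivative has integral zero.
theorem laplaceKernel_integral_succ {s c : ℝ} (hs : 0 < s) (hc : 0 < c) (y : ℝ) :
    (c + y * Complex.I) * ∫ t : ℝ in Ioi 0, (t : ℂ) ^ (((s + 1 : ℝ) : ℂ) - 1) *
      Complex.exp (-((c + y * Complex.I) * t)) =
    s * ∫ t : ℝ in Ioi 0, (t : ℂ) ^ ((s : ℂ) - 1) *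
      Complex.exp (-((c + y * Complex.I) * t)) := by
  set r : ℂ := c + y * Complex.I with hr
  have i1 := (integrableOn_laplaceKernel (add_pos hs one_pos) hc y).const_mul r
  have i0 := (integrableOn_laplaceKernel hs hc y).const_mul (s : ℂ)
  have key := integral_Ioi_of_hasDerivAt_of_tendsto (a := 0) (m := 0)
    (f := fun t : ℝ => (t : ℂ) ^ (s : ℂ) * Complex.exp (-(r * t)))
    (f' := fun t : ℝ => (s : ℂ) * ((t : ℂ) ^ ((s : ℂ) - 1) * Complex.exp (-(r * t))) -
      r * ((t : ℂ) ^ (((s + 1 : ℝ) : ℂ) - 1) * Complex.exp (-(r * t)))) ?_ ?_ ?_ ?_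
  · rw [integral_sub i0 i1, integral_const_mul, integral_const_mul] at key
    rw [eq_comm, ← sub_eq_zero, key]
    have : (s : ℂ) ≠ 0 := by exact_mod_cast hs.ne'
    simp [Complex.zero_cpow this]
  · refine ContinuousAt.continuousWithinAt ?_
    refine ContinuousAt.mul ?_ (by fun_prop)
    exact Complex.continuousAt_ofReal_cpow_const 0 s (Or.inl (by simpa using hs))
  · intro t ht
    have ht' : (t : ℂ) ∈ Complex.slitPlane := Complex.ofReal_mem_slitPlane.2 ht
    have h1 := ((hasDerivAt_id (t : ℂ)).cpow_const (c := (s : ℂ)) ht').comp_ofReal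
    have h2 : HasDerivAt (fun t : ℝ => Complex.exp (-(r * t))) (Complex.exp (-(r * t)) * (-r)) t := by
      have := (((hasDerivAt_id (t : ℂ)).const_mul r).neg.cexp).comp_ofReal
      simpa using this
    refine (h1.mul h2).congr_deriv ?_
    simp only [id, Complex.ofReal_add, Complex.ofReal_one, add_sub_cancel_right, mul_one]
    ring
  · exact i0.sub i1
  · rw [tendsto_zero_iff_norm_tendsto_zero]
    have h := tendsto_rpow_mul_exp_neg_mul_atTop_nhds_zero s c hc
    refine h.congr' ?_
    filter_upwards [eventually_gt_atTop 0] with t ht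
    rw [norm_mul, Complex.norm_exp, Complex.norm_cpow_eq_rpow_re_of_pos ht]
    simp [hr]

open MeasureTheory Set in
theorem hasDerivAt_laplaceKernel_integral {s c : ℝ} (hs : 0 < s) (hc : 0 < c) (y : ℝ) :
    HasDerivAt (fun y : ℝ => ∫ t : ℝ in Ioi 0, (t : ℂ) ^ ((s : ℂ) - 1) *
      Complex.exp (-((c + y * Complex.I) * t)))
    (-Complex.I * ∫ t : ℝ in Ioi 0, (t : ℂ) ^ (((s + 1 : ℝ) : ℂ) - 1) *
      Complex.exp (-((c + y * Complex.I) * t))) y := by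
  rw [← integral_const_mul]
  refine (hasDerivAt_integral_of_dominated_loc_of_deriv_le (s := univ)
    (bound := fun t => t ^ (s + 1 - 1) * Real.exp (-(c * t)))
    (F' := fun (y : ℝ) (t : ℝ) => -Complex.I * ((t : ℂ) ^ (((s + 1 : ℝ) : ℂ) - 1) *
      Complex.exp (-((c + y * Complex.I) * t))))
    univ_mem ?_ ?_ ?_ ?_ ?_ ?_).2
  · exact Eventually.of_forall fun y => aestronglyMeasurable_laplaceKernel s c y
  · exact integrableOn_laplaceKernel hs hc y
  · exact (aestronglyMeasurable_laplaceKernel (s + 1) c y).const_mul _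
  · filter_upwards [ae_restrict_mem measurableSet_Ioi] with t ht y _
    rw [norm_mul, norm_laplaceKernel ht]
    simp
  · exact integrableOn_rpow_mul_exp_neg_mul (by linarith) hc
  · filter_upwards [ae_restrict_mem measurableSet_Ioi] with t ht y _
    have h0 : (t : ℂ) ≠ 0 := by exact_mod_cast (ne_of_gt ht)
    have e : (t : ℂ) ^ (((s + 1 : ℝ) : ℂ) - 1) = (t : ℂ) ^ ((s : ℂ) - 1) * t := by
      rw [cpow_sub_one_mul_self h0]; simp
    have h2 := ((((((hasDerivAt_id (y : ℂ)).mul_const Complex.I).const_add (c : ℂ)).mul_const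
      (t : ℂ)).neg.cexp).const_mul ((t : ℂ) ^ ((s : ℂ) - 1))).comp_ofReal
    refine h2.congr_deriv ?_
    rw [e]
    simp only [id, Pi.neg_apply, one_mul]
    ring

/-- The Laplace transform of `t ^ (s - 1)` on a vertical line. -/
theorem laplaceKernel_integral {s c : ℝ} (hs : 0 < s) (hc : 0 < c) (y : ℝ) :
    ∫ t : ℝ in Set.Ioi 0, (t : ℂ) ^ ((s : ℂ) - 1) *
      Complex.exp (-((c + y * Complex.I) * t)) =
    Real.Gamma s * (c + y * Complex.I) ^ (-(s : ℂ)) := by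
  set L : ℝ → ℝ → ℂ := fun s y => ∫ t : ℝ in Set.Ioi 0, (t : ℂ) ^ ((s : ℂ) - 1) *
      Complex.exp (-((c + y * Complex.I) * t)) with hL
  have hslit : ∀ y : ℝ, (c + y * Complex.I : ℂ) ∈ Complex.slitPlane := fun y =>
    Or.inl (by simpa using hc)
  -- In `y`, the transform has derivative `-i L (s+1) y`, and integration by parts makes this cancel
  -- the derivative of the power. The product is thus constant, and its value is known at `y = 0`.
  have hconst : ∀ y : ℝ, L s y * (c + y * Complex.I) ^ (s : ℂ) =
      L s 0 * (c + (0 : ℝ) * Complex.I) ^ (s : ℂ) := by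
    intro y
    have hd : ∀ y : ℝ, HasDerivAt (fun y : ℝ => L s y * (c + y * Complex.I) ^ (s : ℂ)) 0 y := by
      intro y
      have h1 := hasDerivAt_laplaceKernel_integral hs hc y
      have h2 := ((((hasDerivAt_id (y : ℂ)).mul_const Complex.I).const_add (c : ℂ)).cpow_const
        (c := (s : ℂ)) (hslit y)).comp_ofReal
      have h3 := laplaceKernel_integral_succ hs hc y
      have h0 := Complex.slitPlane_ne_zero (hslit y)
      refine (h1.mul h2).congr_deriv ?_
      have e : (c + y * Complex.I : ℂ) ^ (s : ℂ) =
          (c + y * Complex.I : ℂ) ^ ((s : ℂ) - 1) * (c + y * Complex.I) :=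
        (cpow_sub_one_mul_self h0 _).symm
      simp only [id, one_mul]
      rw [e]
      linear_combination (-Complex.I * (c + y * Complex.I : ℂ) ^ ((s : ℂ) - 1)) * h3
    exact is_const_of_deriv_eq_zero (fun y => (hd y).differentiableAt) (fun y => (hd y).deriv) y 0
  have h00 : L s 0 = (1 / (c : ℂ)) ^ (s : ℂ) * Complex.Gamma s := by
    rw [← Complex.integral_cpow_mul_exp_neg_mul_Ioi (by simpa using hs) hc]
    simp [hL]
  have h0 := Complex.slitPlane_ne_zero (hslit y)
  have h1 := hconst y
  have hc' : (c : ℂ) ≠ 0 := by exact_mod_cast hc.ne'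
  have harg : (c : ℂ).arg ≠ Real.pi := by
    rw [Complex.arg_ofReal_of_nonneg hc.le]; exact Real.pi_pos.ne
  rw [h00, one_div, Complex.inv_cpow _ _ harg] at h1
  simp only [Complex.ofReal_zero, zero_mul, add_zero] at h1
  have hcp : (c : ℂ) ^ (s : ℂ) ≠ 0 := by simp [Complex.cpow_eq_zero_iff, hc']
  have hrp : (c + y * Complex.I : ℂ) ^ (s : ℂ) ≠ 0 := by simp [Complex.cpow_eq_zero_iff, h0]
  change L s y = _
  rw [Complex.cpow_neg, ← Complex.Gamma_ofReal]
  field_simp at h1 ⊢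
  rw [h1]

/-! ### The Bromwich integral of the reciprocal Gamma function -/

/-- Two of the `μ` powers supply the decay, since `1 + y² ≤ r² (c⁻² + 1)`; the others are bounded by
their value at `c`. This is the common source of integrable majorants on vertical lines. -/
theorem rpow_neg_le_of_le {c μ y r : ℝ} (hc : 0 < c) (hμ : 2 ≤ μ) (hcr : c ≤ r) (hy : |y| ≤ r) :
    r ^ (-μ) ≤ c ^ (-(μ - 2)) * (1 + (c ^ 2)⁻¹) * (1 + y ^ 2)⁻¹ := by
  have hr : 0 < r := hc.trans_le hcr
  have h1 : r ^ (-(μ - 2)) ≤ c ^ (-(μ - 2)) :=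
    Real.rpow_le_rpow_of_nonpos hc hcr (by linarith)
  have h2 : (r ^ 2)⁻¹ ≤ (1 + (c ^ 2)⁻¹) * (1 + y ^ 2)⁻¹ := by
    have hy2 : y ^ 2 ≤ r ^ 2 := by rw [← sq_abs y]; gcongr
    have hc2 : c ^ 2 ≤ r ^ 2 := by gcongr
    have hc3 : 1 ≤ r ^ 2 * (c ^ 2)⁻¹ := by rwa [le_mul_inv_iff₀ (by positivity), one_mul]
    rw [← div_eq_mul_inv, le_div_iff₀ (by positivity), inv_mul_le_iff₀ (by positivity)]
    linarith
  have h3 : r ^ (-μ) = r ^ (-(μ - 2)) * (r ^ 2)⁻¹ := by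
    rw [← Real.rpow_natCast, ← Real.rpow_neg hr.le, ← Real.rpow_add hr]; congr 1; push_cast; ring
  rw [h3, mul_assoc]
  gcongr

theorem abs_le_norm_add_mul_I (c y : ℝ) : |y| ≤ ‖(c + y * Complex.I : ℂ)‖ := by
  simpa using Complex.abs_im_le_norm (c + y * Complex.I)

theorem le_norm_add_mul_I (c y : ℝ) : c ≤ ‖(c + y * Complex.I : ℂ)‖ := by
  simpa using Complex.re_le_norm (c + y * Complex.I)

open MeasureTheory in
theorem integrable_const_mul_inv_one_add_sq (K : ℝ) : Integrable fun y : ℝ => K * (1 + y ^ 2)⁻¹ :=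
  integrable_inv_one_add_sq.const_mul K

open MeasureTheory in
theorem integrable_cpow_vertical {c s : ℝ} (hc : 0 < c) (hs : 2 ≤ s) :
    Integrable fun y : ℝ => (c + y * Complex.I : ℂ) ^ (-(s : ℂ)) := by
  refine (integrable_const_mul_inv_one_add_sq _).mono' ?_ (Eventually.of_forall fun y => ?_)
    (g := fun y => c ^ (-(s - 2)) * (1 + (c ^ 2)⁻¹) * (1 + y ^ 2)⁻¹)
  · refine Continuous.aestronglyMeasurable (continuous_iff_continuousAt.2 fun y => ?_)
    have : (c + y * Complex.I : ℂ) ∈ Complex.slitPlane := Or.inl (by simpa using hc)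
    fun_prop (disch := assumption)
  · rw [← Complex.ofReal_neg, Complex.norm_cpow_real]
    exact rpow_neg_le_of_le hc hs (le_norm_add_mul_I c y) (abs_le_norm_add_mul_I c y)

open MeasureTheory FourierTransform in
/-- The Bromwich integral for the reciprocal Gamma function. -/
theorem integral_exp_mul_cpow_vertical {c s : ℝ} (hc : 0 < c) (hs : 2 ≤ s) :
    ∫ y : ℝ, Complex.exp (c + y * Complex.I) * (c + y * Complex.I : ℂ) ^ (-(s : ℂ)) =
      ((2 * Real.pi / Real.Gamma s : ℝ) : ℂ) := by
  have hs0 : 0 < s := by linarith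
  set k : ℝ → ℂ := fun t => (t : ℂ) ^ ((s : ℂ) - 1) * Complex.exp (-((c + (0 : ℝ) * Complex.I) * t))
  set f : ℝ → ℂ := Set.indicator (Set.Ioi 0) k with hf
  set g : ℝ → ℂ := fun y => Complex.exp (y * Complex.I) * (c + y * Complex.I : ℂ) ^ (-(s : ℂ))
  -- The Fourier transform of the damped power `t^(s-1) e^(-ct)` is its Laplace transform on the
  -- line, with `y = 2πw`. Inversion at `t = 1`, where the damped power is `e^(-c)`, gives the
  -- Bromwich integral.
  have hFf : 𝓕 f = fun w => (Real.Gamma s : ℂ) *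
      (c + (2 * Real.pi * w : ℝ) * Complex.I : ℂ) ^ (-(s : ℂ)) := by
    ext w
    rw [Real.fourier_real_eq_integral_exp_smul, ← laplaceKernel_integral hs0 hc,
      ← integral_indicator measurableSet_Ioi]
    congr 1
    ext t
    by_cases ht : t ∈ Set.Ioi (0 : ℝ)
    · simp only [hf, Set.indicator_of_mem ht, k, smul_eq_mul]
      rw [mul_left_comm, ← Complex.exp_add]
      congr 2
      push_cast
      ring
    · simp [hf, Set.indicator_of_notMem ht]
  have hint : Integrable f :=
    (integrable_indicator_iff measurableSet_Ioi).2 (integrableOn_laplaceKernel hs0 hc 0)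
  have hFint : Integrable (𝓕 f) := by
    rw [hFf]
    exact (((integrable_cpow_vertical hc hs).comp_mul_left' (R := 2 * Real.pi)
      (by positivity)).const_mul _)
  have hcont : ContinuousAt f 1 := by
    have : f =ᶠ[𝓝 1] k := by
      filter_upwards [Ioi_mem_nhds (zero_lt_one' ℝ)] with t ht
      exact Set.indicator_of_mem ht k
    refine ContinuousAt.congr ?_ this.symm
    have : ((1 : ℝ) : ℂ) ∈ Complex.slitPlane := Complex.ofReal_mem_slitPlane.2 one_pos
    fun_prop (disch := assumption)
  have hinv := hint.fourierInv_fourier_eq hFint hcont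
  have hf1 : f 1 = Complex.exp (-c) := by
    rw [hf, Set.indicator_of_mem (by simp)]
    simp [k]
  rw [hFf, hf1, Real.fourierInv_eq'] at hinv
  have h2 : ∫ w : ℝ, g (2 * Real.pi * w) = (2 * Real.pi : ℝ)⁻¹ • ∫ y, g y := by
    rw [Measure.integral_comp_mul_left g, abs_of_pos (by positivity)]
  have h3 : (Real.Gamma s : ℂ) * ∫ w : ℝ, g (2 * Real.pi * w) = Complex.exp (-c) := by
    rw [← hinv, ← integral_const_mul]
    congr 1
    ext w
    simp only [g, smul_eq_mul]
    rw [mul_left_comm]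
    congr 3
    simp
  rw [h2] at h3
  have hG : (Real.Gamma s : ℂ) ≠ 0 := by exact_mod_cast (Real.Gamma_pos_of_pos hs0).ne'
  have hpi : (Real.pi : ℂ) ≠ 0 := by exact_mod_cast Real.pi_ne_zero
  have h4 : ∫ y, g y = 2 * Real.pi / Real.Gamma s * Complex.exp (-c) := by
    rw [Complex.real_smul] at h3
    push_cast at h3
    field_simp at h3 ⊢
    linear_combination h3
  calc _ = ∫ y, Complex.exp c * g y := by
        congr 1; ext y; simp only [g, Complex.exp_add]; ring
    _ = _ := by
      rw [integral_const_mul, h4, mul_left_comm, ← Complex.exp_add]; simp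

/-! ### Rotation of the contour -/

open MeasureTheory in
theorem integral_eq_two_mul_re_of_conj {F : ℝ → ℂ} (hF : Integrable F)
    (hconj : ∀ y, F (-y) = (starRingEnd ℂ) (F y)) :
    ∫ y, F y = ((2 * (∫ y in Set.Ioi 0, F y).re : ℝ) : ℂ) := by
  rw [← intervalIntegral.integral_Iic_add_Ioi (b := 0) hF.integrableOn hF.integrableOn]
  have h1 : ∫ y in Set.Iic 0, F y = (starRingEnd ℂ) (∫ y in Set.Ioi 0, F y) := by
    rw [← integral_conj, ← neg_zero, ← integral_comp_neg_Ioi]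
    simp [hconj]
  rw [h1, add_comm, Complex.add_conj]

/-- The point at parameter `y` of the ray from `c` in the direction `I - d`. -/
def rayPoint (c d y : ℝ) : ℂ := c + y * (Complex.I - d)

theorem rayPoint_re (c d y : ℝ) : (rayPoint c d y).re = c - d * y := by
  simp [rayPoint]; ring

theorem rayPoint_im (c d y : ℝ) : (rayPoint c d y).im = y := by
  simp [rayPoint]

theorem rayPoint_mem_slitPlane {c d y : ℝ} (hc : 0 < c) : rayPoint c d y ∈ Complex.slitPlane := by
  rw [Complex.mem_slitPlane_iff, rayPoint_re, rayPoint_im]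
  rcases eq_or_ne y 0 with rfl | h
  · left; simpa using hc
  · exact Or.inr h

theorem rayPoint_zero_left (c d : ℝ) : rayPoint c d 0 = c := by simp [rayPoint]

theorem abs_le_norm_rayPoint (c d y : ℝ) : |y| ≤ ‖rayPoint c d y‖ := by
  have := Complex.abs_im_le_norm (rayPoint c d y)
  rwa [rayPoint_im] at this

theorem half_le_norm_rayPoint {c d y : ℝ} (hd : d ≤ 1) (hy : 0 ≤ y) :
    c / 2 ≤ ‖rayPoint c d y‖ := by
  rcases le_total (c / 2) y with h | h
  · exact (h.trans (le_abs_self y)).trans (abs_le_norm_rayPoint c d y)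
  · have := Complex.re_le_norm (rayPoint c d y)
    rw [rayPoint_re] at this
    nlinarith

theorem norm_rayPoint_le {c d y : ℝ} (hc : 0 ≤ c) (hd0 : 0 ≤ d) (hd : d ≤ 1) (hy : 0 ≤ y) :
    ‖rayPoint c d y‖ ≤ c + 2 * y := by
  have h1 : ‖(Complex.I - d : ℂ)‖ ≤ 2 := by
    refine (norm_sub_le _ _).trans ?_
    rw [Complex.norm_I, Complex.norm_real, Real.norm_of_nonneg hd0]; linarith
  refine (norm_add_le _ _).trans ?_
  rw [norm_mul, Complex.norm_real, Complex.norm_real, Real.norm_of_nonneg hc, Real.norm_of_nonneg hy]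
  nlinarith

theorem hasDerivAt_rayPoint (c d y : ℝ) : HasDerivAt (rayPoint c d) (Complex.I - d) y := by
  have := (((hasDerivAt_id (y : ℂ)).mul_const (Complex.I - d)).const_add (c : ℂ)).comp_ofReal
  exact this.congr_deriv (one_mul _)

theorem continuous_rayPoint (c d : ℝ) : Continuous (rayPoint c d) := by
  unfold rayPoint; fun_prop

/-- All the rays, cut at height `R`, lie in one disc about `c + iR`. It misses the nonpositive real
axis, whose points are at squared distance at least `R² + c²` from the centre. A primitive on this
disc replaces Cauchy's theorem on a triangle. -/
theorem rayPoint_mem_ball {c d y R : ℝ} (hc : 0 < c) (hd0 : 0 ≤ d) (hd : d ≤ 1)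
    (hy : 0 ≤ y) (hyR : y ≤ R) :
    rayPoint c d y ∈ Metric.ball (c + R * Complex.I : ℂ) (Real.sqrt (R ^ 2 + c ^ 2 / 2)) := by
  rw [mem_ball_iff_norm, Complex.norm_eq_sqrt_sq_add_sq]
  refine Real.sqrt_lt_sqrt (by positivity) ?_
  have h1 : (rayPoint c d y - (c + R * Complex.I)).re = - (d * y) := by
    rw [Complex.sub_re, rayPoint_re]; simp
  have h2 : (rayPoint c d y - (c + R * Complex.I)).im = y - R := by
    rw [Complex.sub_im, rayPoint_im]; simp
  rw [h1, h2]
  have : d ^ 2 * y ^ 2 ≤ 1 * y ^ 2 := by gcongr; nlinarith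
  nlinarith [sq_pos_of_pos hc, mul_nonneg hy (sub_nonneg.2 hyR)]

theorem ball_subset_slitPlane {c R : ℝ} (hc : 0 < c) :
    Metric.ball (c + R * Complex.I : ℂ) (Real.sqrt (R ^ 2 + c ^ 2 / 2)) ⊆ Complex.slitPlane := by
  intro z hz
  rw [mem_ball_iff_norm, Complex.norm_eq_sqrt_sq_add_sq] at hz
  have hz := (Real.sqrt_lt_sqrt_iff (by positivity)).1 hz
  rw [Complex.mem_slitPlane_iff]
  by_contra! h
  simp [h.2] at hz
  nlinarith [sq_pos_of_pos hc]

open MeasureTheory in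
theorem integrableOn_comp_rayPoint {G : ℂ → ℂ} {c d B : ℝ} (hc : 0 < c)
    (hG : ContinuousOn G Complex.slitPlane)
    (hB : ∀ y, 0 ≤ y → ‖G (rayPoint c d y)‖ ≤ B * (1 + y ^ 2)⁻¹) :
    IntegrableOn (fun y => G (rayPoint c d y)) (Set.Ioi 0) := by
  refine (integrable_const_mul_inv_one_add_sq B).integrableOn.mono' ?_ ?_
  · refine Continuous.aestronglyMeasurable ?_
    exact hG.comp_continuous (continuous_rayPoint c d) fun y => rayPoint_mem_slitPlane hc
  · filter_upwards [ae_restrict_mem measurableSet_Ioi] with y hy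
    exact hB y (le_of_lt hy)

open MeasureTheory in
/-- Rotating the upper half of a vertical line to the left, for integrands of quadratic decay. -/
theorem integral_rayPoint_eq_vertical {G : ℂ → ℂ} {c d B : ℝ} (hc : 0 < c) (hd0 : 0 ≤ d)
    (hd : d ≤ 1) (hG : DifferentiableOn ℂ G Complex.slitPlane)
    (hB : ∀ e, 0 ≤ e → e ≤ d → ∀ y, 0 ≤ y → ‖G (rayPoint c e y)‖ ≤ B * (1 + y ^ 2)⁻¹) :
    ∫ y in Set.Ioi 0, G (rayPoint c d y) * (Complex.I - d) =
      ∫ y in Set.Ioi 0, G (rayPoint c 0 y) * Complex.I := by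
  have hint : ∀ e, 0 ≤ e → e ≤ d → Tendsto
      (fun R : ℝ => ∫ y in (0 : ℝ)..R, G (rayPoint c e y) * (Complex.I - e)) atTop
      (𝓝 (∫ y in Set.Ioi 0, G (rayPoint c e y) * (Complex.I - e))) := fun e he he' =>
    intervalIntegral_tendsto_integral_Ioi 0
      ((integrableOn_comp_rayPoint hc hG.continuousOn (hB e he he')).mul_const _) tendsto_id
  have h0 := hint 0 le_rfl hd0
  simp only [Complex.ofReal_zero, sub_zero] at h0
  refine eq_of_sub_eq_zero (tendsto_nhds_unique ((hint d hd0 le_rfl).sub h0) ?_)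
  have hlim : Tendsto (fun R : ℝ => B * d * (R * (1 + R ^ 2)⁻¹)) atTop (𝓝 0) := by
    rw [← mul_zero (B * d)]
    refine Tendsto.const_mul _ ?_
    refine squeeze_zero' (g := fun R : ℝ => R⁻¹) ?_ ?_ tendsto_inv_atTop_zero
    · filter_upwards [eventually_gt_atTop 0] with R hR
      positivity
    · filter_upwards [eventually_gt_atTop 0] with R hR
      rw [← div_eq_mul_inv, div_le_iff₀ (by positivity), mul_add]
      have : R⁻¹ * R ^ 2 = R := by field_simp
      rw [this]
      have : 0 < R⁻¹ := by positivity
      linarith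
  refine squeeze_zero_norm' ?_ hlim
  filter_upwards [eventually_gt_atTop 0] with R hR
  obtain ⟨P, hP⟩ := (hG.mono (ball_subset_slitPlane (R := R) hc)).isExactOn_ball
  have hftc : ∀ e, 0 ≤ e → e ≤ d →
      ∫ y in (0 : ℝ)..R, G (rayPoint c e y) * (Complex.I - e) = P (rayPoint c e R) - P c := by
    intro e he he'
    rw [intervalIntegral.integral_eq_sub_of_hasDerivAt (f := fun y => P (rayPoint c e y)),
      rayPoint_zero_left]
    · intro y hy
      rw [Set.uIcc_of_le hR.le] at hy
      exact (hP _ (rayPoint_mem_ball hc he (he'.trans hd) hy.1 hy.2)).comp_of_eq y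
        (hasDerivAt_rayPoint c e y) rfl
    · refine Continuous.intervalIntegrable ?_ _ _
      exact (hG.continuousOn.comp_continuous (continuous_rayPoint c e)
        fun y => rayPoint_mem_slitPlane hc).mul continuous_const
  have e0 := hftc 0 le_rfl hd0
  simp only [Complex.ofReal_zero, sub_zero] at e0
  rw [hftc d hd0 le_rfl, e0, sub_sub_sub_cancel_right]
  -- The horizontal segment at height `R` that joins the two rays has length `d R`, while `G` is at
  -- most `B / (1 + R²)` on it.
  have hmv := (convex_Icc (0 : ℝ) d).norm_image_sub_le_of_norm_hasDerivWithin_le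
    (f := fun e : ℝ => P (rayPoint c e R)) (f' := fun e => G (rayPoint c e R) * (-R))
    (C := B * (1 + R ^ 2)⁻¹ * R) (x := 0) (y := d) ?_ ?_ ⟨le_rfl, hd0⟩ ⟨hd0, le_rfl⟩
  · rw [sub_zero, Real.norm_of_nonneg hd0] at hmv
    linarith
  · intro e he
    have h1 : HasDerivAt (fun e : ℝ => rayPoint c e R) (-R : ℂ) e := by
      have := ((((hasDerivAt_id (e : ℂ)).const_sub Complex.I).const_mul (R : ℂ)).const_add
        (c : ℂ)).comp_ofReal
      exact this.congr_deriv (mul_neg_one _)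
    exact ((hP _ (rayPoint_mem_ball hc he.1 (he.2.trans hd) hR.le le_rfl)).comp_of_eq e
      h1 rfl).hasDerivWithinAt
  · intro e he
    rw [norm_mul, norm_neg, Complex.norm_real, Real.norm_of_nonneg hR.le]
    gcongr
    exact hB e he.1 he.2 R hR.le

/-! ### Hankel's integral on a ray -/

theorem exists_rpow_mul_exp_rpow_le {c ε q : ℝ} (hc : 0 < c) (hε : 0 < ε) (hq : q < 1) (p K : ℝ) :
    ∃ C, ∀ r, c ≤ r → r ^ p * Real.exp (K * r ^ q) ≤ C * Real.exp (ε * r) := by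
  have h1 : ∀ᶠ r : ℝ in atTop, r ^ p * Real.exp (-(ε / 2) * r) ≤ 1 :=
    (tendsto_rpow_mul_exp_neg_mul_atTop_nhds_zero p (ε / 2) (by positivity)).eventually_le_const
      one_pos
  have h2 : ∀ᶠ r : ℝ in atTop, K * r ^ (-(1 - q)) ≤ ε / 2 := by
    have := (tendsto_rpow_neg_atTop (sub_pos.2 hq)).const_mul K
    rw [mul_zero] at this
    exact this.eventually_le_const (by positivity)
  obtain ⟨R, hR⟩ := eventually_atTop.1 (h1.and (h2.and (eventually_gt_atTop 0)))
  have hcont : ContinuousOn (fun r : ℝ => r ^ p * Real.exp (K * r ^ q)) (Set.Icc c R) := by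
    intro r hr
    have : r ≠ 0 := (hc.trans_le hr.1).ne'
    refine ContinuousAt.continuousWithinAt ?_
    exact (Real.continuousAt_rpow_const r p (Or.inl this)).mul
      ((Real.continuousAt_rpow_const r q (Or.inl this)).const_mul K).rexp
  obtain ⟨C, hC⟩ := isCompact_Icc.bddAbove_image hcont
  refine ⟨max C 1, fun r hr => ?_⟩
  have hr0 : 0 < r := hc.trans_le hr
  rcases le_total r R with h | h
  · have h3 : r ^ p * Real.exp (K * r ^ q) ≤ C := hC ⟨r, ⟨hr, h⟩, rfl⟩
    have h4 : 1 ≤ Real.exp (ε * r) := Real.one_le_exp (by positivity)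
    have h5 : (1 : ℝ) ≤ max C 1 := le_max_right _ _
    nlinarith [le_max_left C 1]
  · obtain ⟨g1, g2, -⟩ := hR r h
    have h3 : K * r ^ q ≤ ε / 2 * r := by
      have e : r ^ q = r ^ (-(1 - q)) * r := by
        rw [← Real.rpow_add_one hr0.ne']; congr 1; ring
      rw [e, ← mul_assoc]
      gcongr
    calc r ^ p * Real.exp (K * r ^ q) ≤ r ^ p * Real.exp (ε / 2 * r) := by gcongr
      _ = r ^ p * Real.exp (-(ε / 2) * r) * Real.exp (ε * r) := by
        rw [mul_assoc, ← Real.exp_add]; congr 2; ring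
      _ ≤ max C 1 * Real.exp (ε * r) := by
        gcongr; exact g1.trans (le_max_right _ _)

theorem norm_exp_rayPoint (c d y : ℝ) :
    ‖Complex.exp (rayPoint c d y)‖ = Real.exp (c - d * y) := by
  rw [Complex.norm_exp, rayPoint_re]

theorem norm_I_sub_le {d : ℝ} (hd0 : 0 ≤ d) (hd : d ≤ 1) : ‖(Complex.I - d : ℂ)‖ ≤ 2 := by
  refine (norm_sub_le _ _).trans ?_
  rw [Complex.norm_I, Complex.norm_real, Real.norm_of_nonneg hd0]; linarith

open MeasureTheory in
theorem integrableOn_ray_majorant {c d q : ℝ} (hc : 0 < c) (hd0 : 0 < d) (hd : d ≤ 1)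
    (hq : q < 1) (p K : ℝ) :
    IntegrableOn (fun y : ℝ => Real.exp (c - d * y) * (‖rayPoint c d y‖ ^ p *
      Real.exp (K * ‖rayPoint c d y‖ ^ q))) (Set.Ioi 0) := by
  -- On the ray `‖t‖ ≤ c + 2y`, so the rate `d/4` costs a factor `e^(dy/2)` and leaves half of the
  -- decay `e^(-dy)`.
  obtain ⟨C, hC⟩ := exists_rpow_mul_exp_rpow_le (half_pos hc) (show 0 < d / 4 by positivity) hq p K
  have hC0 : 0 ≤ C := by
    by_contra h
    have := hC (c / 2) le_rfl
    have h1 : 0 ≤ (c / 2) ^ p * Real.exp (K * (c / 2) ^ q) := by positivity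
    nlinarith [Real.exp_pos (d / 4 * (c / 2))]
  have hg : IntegrableOn (fun y : ℝ => C * Real.exp (c + d / 4 * c) * Real.exp (-(d / 2) * y))
      (Set.Ioi 0) := (exp_neg_integrableOn_Ioi 0 (by positivity)).const_mul _
  refine hg.mono' ?_ ?_
  · refine ContinuousOn.aestronglyMeasurable (fun y hy => ?_) measurableSet_Ioi
    refine ContinuousAt.continuousWithinAt ?_
    have h0 : ‖rayPoint c d y‖ ≠ 0 :=
      norm_ne_zero_iff.2 (Complex.slitPlane_ne_zero (rayPoint_mem_slitPlane hc))
    have hn : ContinuousAt (fun y => ‖rayPoint c d y‖) y := (continuous_rayPoint c d).norm.continuousAt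
    refine ContinuousAt.mul (by fun_prop) ((hn.rpow_const (Or.inl h0)).mul ?_)
    exact ((hn.rpow_const (Or.inl h0)).const_mul K).rexp
  · filter_upwards [ae_restrict_mem measurableSet_Ioi] with y hy
    rw [Real.norm_of_nonneg (by positivity)]
    have hy' : 0 ≤ y := le_of_lt hy
    calc _ ≤ Real.exp (c - d * y) * (C * Real.exp (d / 4 * ‖rayPoint c d y‖)) := by
          exact mul_le_mul_of_nonneg_left (hC _ (half_le_norm_rayPoint hd hy')) (Real.exp_pos _).le
      _ ≤ Real.exp (c - d * y) * (C * Real.exp (d / 4 * (c + 2 * y))) := by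
          gcongr; exact norm_rayPoint_le hc.le hd0.le hd hy'
      _ = C * (Real.exp (c - d * y) * Real.exp (d / 4 * (c + 2 * y))) := by ring
      _ = C * (Real.exp (c + d / 4 * c) * Real.exp (-(d / 2) * y)) := by
          rw [← Real.exp_add, ← Real.exp_add]; congr 2; ring
      _ ≤ _ := by rw [mul_assoc]

/-- The integrand of the Hankel type representation of the Wright function. -/
def wrightKernel (lam mu z : ℝ) (t : ℂ) : ℂ :=
  Complex.exp (t + z * t ^ (-(lam : ℂ))) * t ^ (-(mu : ℂ))

theorem differentiableOn_wrightKernel (lam mu z : ℝ) :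
    DifferentiableOn ℂ (wrightKernel lam mu z) Complex.slitPlane := by
  intro t ht
  unfold wrightKernel
  refine DifferentiableAt.differentiableWithinAt ?_
  fun_prop (disch := assumption)

theorem norm_wrightKernel (lam mu z : ℝ) (t : ℂ) :
    ‖wrightKernel lam mu z t‖ =
      Real.exp t.re * ‖Complex.exp (z * t ^ (-(lam : ℂ)))‖ * ‖t‖ ^ (-mu) := by
  rw [wrightKernel, norm_mul, Complex.exp_add, norm_mul, Complex.norm_exp, ← Complex.ofReal_neg mu,
    Complex.norm_cpow_real]

/-- With `z = 0` the kernel is Hankel's own, so the norm and differentiability lemmas for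
`wrightKernel` serve for `1/Γ` too. -/
theorem wrightKernel_zero (lam mu : ℝ) (t : ℂ) :
    wrightKernel lam mu 0 t = Complex.exp t * t ^ (-(mu : ℂ)) := by
  simp [wrightKernel]

open MeasureTheory in
theorem integrableOn_wrightKernel_zero {c d : ℝ} (hc : 0 < c) (hd0 : 0 < d) (hd : d ≤ 1) (s : ℝ) :
    IntegrableOn (fun y : ℝ => wrightKernel 0 s 0 (rayPoint c d y)) (Set.Ioi 0) := by
  refine (integrableOn_ray_majorant hc hd0 hd zero_lt_one (-s) 0).mono' ?_ ?_
  · refine Continuous.aestronglyMeasurable ?_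
    exact (differentiableOn_wrightKernel 0 s 0).continuousOn.comp_continuous
      (continuous_rayPoint c d) fun y => rayPoint_mem_slitPlane hc
  · refine Eventually.of_forall fun y => le_of_eq ?_
    rw [norm_wrightKernel, rayPoint_re]
    simp

open MeasureTheory in
/-- Hankel's integral for the reciprocal Gamma function, on the upper half of the contour. -/
theorem im_hankel_of_two_le {c d s : ℝ} (hc : 0 < c) (hd0 : 0 ≤ d) (hd : d ≤ 1) (hs : 2 ≤ s) :
    (∫ y in Set.Ioi 0, wrightKernel 0 s 0 (rayPoint c d y) * (Complex.I - d)).im =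
      Real.pi / Real.Gamma s := by
  have hB : ∀ e, 0 ≤ e → e ≤ d → ∀ y, 0 ≤ y → ‖wrightKernel 0 s 0 (rayPoint c e y)‖ ≤
      Real.exp c * ((c / 2) ^ (-(s - 2)) * (1 + ((c / 2) ^ 2)⁻¹)) * (1 + y ^ 2)⁻¹ := by
    intro e he he' y hy
    have h1 := rpow_neg_le_of_le (half_pos hc) hs
      (half_le_norm_rayPoint (c := c) (he'.trans hd) hy) (abs_le_norm_rayPoint c e y)
    rw [norm_wrightKernel, rayPoint_re, mul_assoc (Real.exp c)]
    have h2 : Real.exp (c - e * y) ≤ Real.exp c := by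
      gcongr; nlinarith
    simp only [Complex.ofReal_zero, zero_mul, Complex.exp_zero, norm_one, mul_one]
    gcongr
  rw [integral_rayPoint_eq_vertical hc hd0 hd (differentiableOn_wrightKernel 0 s 0) hB,
    integral_mul_const]
  have hray : ∀ y : ℝ, rayPoint c 0 y = c + y * Complex.I := fun y => by simp [rayPoint]
  have hFi : Integrable fun y : ℝ => Complex.exp (c + y * Complex.I) *
      (c + y * Complex.I : ℂ) ^ (-(s : ℂ)) := by
    refine (integrable_cpow_vertical hc hs).bdd_mul (c := Real.exp c) ?_ ?_
    · exact Continuous.aestronglyMeasurable (by fun_prop)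
    · refine Eventually.of_forall fun y => ?_
      rw [Complex.norm_exp]; simp
  have h := integral_eq_two_mul_re_of_conj hFi fun y => by
    have hc' : (c + y * Complex.I : ℂ).arg ≠ Real.pi :=
      Complex.slitPlane_arg_ne_pi (Or.inl (by simpa using hc))
    rw [map_mul, ← Complex.exp_conj]
    have e : (c + ((-y : ℝ) : ℂ) * Complex.I : ℂ) = (starRingEnd ℂ) (c + y * Complex.I) := by
      simp
    rw [e, Complex.conj_cpow _ _ hc']
    simp
  rw [integral_exp_mul_cpow_vertical hc hs, Complex.ofReal_inj] at h
  simp only [hray, wrightKernel_zero]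
  rw [Complex.mul_I_im]
  linear_combination -h / 2

open MeasureTheory in
-- Integration by parts along the ray. This mirrors `1/Γ(s) = s/Γ(s+1)`.
theorem hankel_succ {c d : ℝ} (hc : 0 < c) (hd0 : 0 < d) (hd : d ≤ 1) (s : ℝ) :
    (∫ y in Set.Ioi 0, wrightKernel 0 s 0 (rayPoint c d y) * (Complex.I - d)).im =
    s * (∫ y in Set.Ioi 0, wrightKernel 0 (s + 1) 0 (rayPoint c d y) * (Complex.I - d)).im := by
  have i0 := (integrableOn_wrightKernel_zero hc hd0 hd s).mul_const (Complex.I - d)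
  have i1 := ((integrableOn_wrightKernel_zero hc hd0 hd (s + 1)).mul_const
    (Complex.I - d)).const_mul (s : ℂ)
  have key := integral_Ioi_of_hasDerivAt_of_tendsto' (a := 0) (m := 0)
    (f := fun y : ℝ => wrightKernel 0 s 0 (rayPoint c d y))
    (f' := fun y : ℝ => wrightKernel 0 s 0 (rayPoint c d y) * (Complex.I - d) -
      s * (wrightKernel 0 (s + 1) 0 (rayPoint c d y) * (Complex.I - d))) ?_ ?_ ?_
  · rw [integral_sub i0 i1, integral_const_mul, rayPoint_zero_left, wrightKernel_zero] at key
    -- The boundary term sits at the real point `c`, hence is real and does not contribute to the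
    -- imaginary part.
    have him : ((0 : ℂ) - Complex.exp c * (c : ℂ) ^ (-(s : ℂ))).im = 0 := by
      rw [← Complex.ofReal_neg, ← Complex.ofReal_cpow hc.le, ← Complex.ofReal_exp,
        ← Complex.ofReal_mul, Complex.sub_im, Complex.ofReal_im]
      simp
    rw [← key, Complex.sub_im, Complex.im_ofReal_mul] at him
    linarith
  · intro y _
    have hsl := rayPoint_mem_slitPlane (d := d) (y := y) hc
    have h0 := Complex.slitPlane_ne_zero hsl
    simp only [wrightKernel_zero]
    have h1 := (hasDerivAt_rayPoint c d y).cexp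
    have h2 := ((hasDerivAt_id _).cpow_const (c := -(s : ℂ)) hsl).comp_of_eq y
      (hasDerivAt_rayPoint c d y) rfl
    refine (h1.mul h2).congr_deriv ?_
    simp only [id, mul_one, Function.comp]
    have e : -((s + 1 : ℝ) : ℂ) = -(s : ℂ) - 1 := by push_cast; ring
    rw [e, show (c + y * (Complex.I - d) : ℂ) = rayPoint c d y from rfl]
    ring
  · exact i0.sub i1
  · obtain ⟨C, hC⟩ := exists_rpow_mul_exp_rpow_le (half_pos hc) (show 0 < d / 4 by positivity)
      zero_lt_one (-s) 0
    have hlim : Tendsto (fun y : ℝ => Real.exp (c - d * y) * (C * Real.exp (d / 4 * (c + 2 * y))))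
        atTop (𝓝 0) := by
      have e : (fun y : ℝ => Real.exp (c - d * y) * (C * Real.exp (d / 4 * (c + 2 * y)))) =
          fun y => C * Real.exp (c + d / 4 * c) * Real.exp (-(d / 2 * y)) := by
        ext y
        rw [mul_left_comm, ← Real.exp_add, mul_assoc, ← Real.exp_add]; congr 2; ring
      rw [e, ← mul_zero (C * Real.exp (c + d / 4 * c))]
      refine Tendsto.const_mul _ (Real.tendsto_exp_neg_atTop_nhds_zero.comp ?_)
      exact tendsto_id.const_mul_atTop (by positivity)
    have hC0 : 0 ≤ C := by
      by_contra h
      have := hC (c / 2) le_rfl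
      have h1 : 0 ≤ (c / 2) ^ (-s) * Real.exp (0 * (c / 2) ^ (0 : ℝ)) := by positivity
      nlinarith [Real.exp_pos (d / 4 * (c / 2))]
    refine squeeze_zero_norm' ?_ hlim
    filter_upwards [eventually_ge_atTop 0] with y hy
    rw [norm_wrightKernel, rayPoint_re]
    simp only [Complex.ofReal_zero, zero_mul, Complex.exp_zero, norm_one, mul_one]
    have h1 := hC _ (half_le_norm_rayPoint (c := c) hd hy)
    simp only [zero_mul, Real.exp_zero, mul_one] at h1
    refine mul_le_mul_of_nonneg_left (h1.trans ?_) (Real.exp_pos _).le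
    gcongr
    exact norm_rayPoint_le hc.le hd0.le hd hy

/-- Valid at the poles as well, including `s = 0`, because `Γ` takes the value `0` there. -/
theorem inv_Gamma_eq_mul_inv_Gamma_add_one (s : ℝ) :
    (Real.Gamma s)⁻¹ = s * (Real.Gamma (s + 1))⁻¹ := by
  rcases eq_or_ne s 0 with rfl | hs
  · simp
  · rw [Real.Gamma_add_one hs, mul_inv, mul_inv_cancel_left₀ hs]

open MeasureTheory in
-- Both sides obey the same recurrence in `s`, which carries the formula from `s ≥ 2` down to all
-- real `s`. The slanted ray is essential: on the vertical line the integrals with small `s` do not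
-- converge absolutely.
theorem im_hankel {c d : ℝ} (hc : 0 < c) (hd0 : 0 < d) (hd : d ≤ 1) (s : ℝ) :
    (∫ y in Set.Ioi 0, wrightKernel 0 s 0 (rayPoint c d y) * (Complex.I - d)).im =
      Real.pi / Real.Gamma s := by
  have key : ∀ n : ℕ, ∀ s : ℝ, 2 ≤ s + n →
      (∫ y in Set.Ioi 0, wrightKernel 0 s 0 (rayPoint c d y) * (Complex.I - d)).im =
        Real.pi / Real.Gamma s := by
    intro n
    induction n with
    | zero => intro s hs; exact im_hankel_of_two_le hc hd0.le hd (by simpa using hs)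
    | succ n ih =>
      intro s hs
      rw [hankel_succ hc hd0 hd, ih (s + 1) (by push_cast at hs; linarith), div_eq_mul_inv,
        div_eq_mul_inv, inv_Gamma_eq_mul_inv_Gamma_add_one s]
      ring
  obtain ⟨n, hn⟩ := exists_nat_ge (2 - s)
  exact key n s (by linarith)

/-! ### The Wright function as a contour integral -/

theorem wrightKernel_term {lam mu : ℝ} {t : ℂ} (ht : t ≠ 0) (n : ℕ) :
    wrightKernel 0 (lam * n + mu) 0 t =
      Complex.exp t * t ^ (-(mu : ℂ)) * (t ^ (-(lam : ℂ))) ^ n := by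
  rw [wrightKernel_zero, mul_assoc, ← Complex.cpow_nat_mul, ← Complex.cpow_add _ _ ht]
  congr 2
  push_cast
  ring

theorem hasSum_wrightKernel {lam mu z : ℝ} {t : ℂ} (ht : t ≠ 0) :
    HasSum (fun n : ℕ => ((z ^ n / n.factorial : ℝ) : ℂ) * wrightKernel 0 (lam * n + mu) 0 t)
      (wrightKernel lam mu z t) := by
  have h := (NormedSpace.expSeries_div_hasSum_exp (z * t ^ (-(lam : ℂ)) : ℂ)).mul_left
    (Complex.exp t * t ^ (-(mu : ℂ)))
  rw [← Complex.exp_eq_exp_ℂ] at h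
  convert! h using 1
  · ext n
    rw [wrightKernel_term ht, mul_pow]
    push_cast
    ring
  · rw [wrightKernel, Complex.exp_add]; ring

open MeasureTheory in
/-- The series of the Wright function converges to its Hankel type integral. -/
theorem hasSum_wright {lam c d : ℝ} (hlam : -1 < lam) (hc : 0 < c) (hd0 : 0 < d) (hd : d ≤ 1)
    (mu z : ℝ) :
    HasSum (fun n : ℕ => z ^ n / ((n.factorial : ℝ) * Real.Gamma (lam * n + mu)))
      ((∫ y in Set.Ioi 0, wrightKernel lam mu z (rayPoint c d y) * (Complex.I - d)).im /
        Real.pi) := by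
  have hne : ∀ y, rayPoint c d y ≠ 0 := fun y =>
    Complex.slitPlane_ne_zero (rayPoint_mem_slitPlane hc)
  -- The dominating series sums to the ray majorant with exponent `q = -lam < 1`; the factor `2`
  -- bounds the direction `I - d`.
  have hbs : ∀ y, HasSum (fun n : ℕ => |z| ^ n / n.factorial * (Real.exp (c - d * y) *
      ‖rayPoint c d y‖ ^ (-mu) * (‖rayPoint c d y‖ ^ (-lam)) ^ n * 2))
      (2 * (Real.exp (c - d * y) * (‖rayPoint c d y‖ ^ (-mu) *
        Real.exp (|z| * ‖rayPoint c d y‖ ^ (-lam))))) := by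
    intro y
    have h := (NormedSpace.expSeries_div_hasSum_exp (|z| * ‖rayPoint c d y‖ ^ (-lam))).mul_left
      (2 * (Real.exp (c - d * y) * ‖rayPoint c d y‖ ^ (-mu)))
    rw [← Real.exp_eq_exp_ℝ] at h
    convert! h using 1
    · ext n
      rw [mul_pow]
      ring
    · ring
  have key := hasSum_integral_of_dominated_convergence (μ := volume.restrict (Set.Ioi (0 : ℝ)))
    (F := fun (n : ℕ) (y : ℝ) => ((z ^ n / n.factorial : ℝ) : ℂ) *
      (wrightKernel 0 (lam * n + mu) 0 (rayPoint c d y) * (Complex.I - d)))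
    (f := fun y => wrightKernel lam mu z (rayPoint c d y) * (Complex.I - d))
    (fun n y => |z| ^ n / n.factorial * (Real.exp (c - d * y) *
      ‖rayPoint c d y‖ ^ (-mu) * (‖rayPoint c d y‖ ^ (-lam)) ^ n * 2)) ?_ ?_ ?_ ?_ ?_
  · have h2 := (Complex.hasSum_im key).div_const Real.pi
    convert! h2 using 1
    ext n
    rw [integral_const_mul, Complex.im_ofReal_mul, im_hankel hc hd0 hd]
    have := Real.pi_ne_zero
    rw [mul_div_assoc, div_div, mul_comm (Real.Gamma _), ← div_div Real.pi, div_self this,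
      one_div, ← div_eq_mul_inv, div_div]
  · intro n
    exact (((integrableOn_wrightKernel_zero hc hd0 hd (lam * n + mu)).mul_const _).const_mul
      _).aestronglyMeasurable
  · intro n
    refine Eventually.of_forall fun y => ?_
    rw [norm_mul, norm_mul, Complex.norm_real, norm_div, norm_pow, Real.norm_eq_abs,
      RCLike.norm_natCast, wrightKernel_term (hne y), norm_mul, norm_mul, norm_exp_rayPoint,
      norm_pow, ← Complex.ofReal_neg, ← Complex.ofReal_neg, Complex.norm_cpow_real,
      Complex.norm_cpow_real]
    gcongr
    exact norm_I_sub_le hd0.le hd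
  · exact Eventually.of_forall fun y => (hbs y).summable
  · simp only [(hbs _).tsum_eq]
    exact (integrableOn_ray_majorant hc hd0 hd (by linarith) _ _).const_mul 2
  · exact Eventually.of_forall fun y => by
      simpa only [mul_assoc] using (hasSum_wrightKernel (hne y)).mul_right (Complex.I - d)

/-- The hypothesis says `|arg t| ≤ (π/2)(2 - m)`. Then `m |arg t| ≤ (π/2) m (2 - m) ≤ π/2`, since `m
(2 - m) = 1 - (1 - m)²`. The sector extends beyond the right half plane, which leaves room to
rotate. -/
theorem cpow_re_nonneg_of_sector {m : ℝ} (hm0 : 0 < m) (hm : m < 1) {t : ℂ} (ht : t ≠ 0)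
    (hre : Real.cos (Real.pi / 2 * (2 - m)) * ‖t‖ ≤ t.re) : 0 ≤ (t ^ (m : ℂ)).re := by
  have hpi := Real.pi_pos
  have hcos : Real.cos (Real.pi / 2 * (2 - m)) ≤ Real.cos |t.arg| := by
    rw [Real.cos_abs, Complex.cos_arg ht, le_div_iff₀ (norm_pos_iff.2 ht)]
    exact hre
  have harg : |t.arg| ≤ Real.pi / 2 * (2 - m) := by
    by_contra! h
    exact absurd hcos (not_le.2 (Real.strictAntiOn_cos
      ⟨by nlinarith, by nlinarith⟩ ⟨abs_nonneg _, Complex.abs_arg_le_pi t⟩ h))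
  rw [Complex.cpow_ofReal_re]
  refine mul_nonneg (by positivity) ?_
  rw [← Real.cos_abs, abs_mul, abs_of_pos hm0]
  refine Real.cos_nonneg_of_mem_Icc ⟨?_, ?_⟩
  · have : 0 ≤ |t.arg| * m := by positivity
    linarith
  · have : |t.arg| * m ≤ Real.pi / 2 * (2 - m) * m := by gcongr
    nlinarith [sq_nonneg (1 - m)]

/-- For `lam ≥ 0` the exponent is bounded away from the origin. For `lam < 0` it grows, but in the
sector its real part is nonpositive because `z ≤ 0`; the slope `d` is the cosine that bounds the
sector. -/
theorem exists_norm_exp_cpow_le {lam z c : ℝ} (hlam : -1 < lam) (hz : z ≤ 0) (hc : 0 < c) :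
    ∃ d, 0 < d ∧ d ≤ 1 ∧ ∃ C, 0 ≤ C ∧ ∀ t : ℂ, c ≤ ‖t‖ → -d * ‖t‖ ≤ t.re →
      ‖Complex.exp (z * t ^ (-(lam : ℂ)))‖ ≤ C := by
  rcases le_or_gt 0 lam with h | h
  · refine ⟨1, one_pos, le_rfl, Real.exp (‖z‖ * c ^ (-lam)), (Real.exp_pos _).le,
      fun t ht _ => ?_⟩
    refine (Complex.norm_exp_le_exp_norm _).trans ?_
    rw [norm_mul, ← Complex.ofReal_neg, Complex.norm_cpow_real, Complex.norm_real]
    exact Real.exp_le_exp.2 (mul_le_mul_of_nonneg_left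
      (Real.rpow_le_rpow_of_nonpos hc ht (by linarith)) (norm_nonneg _))
  · have hpi := Real.pi_pos
    refine ⟨-Real.cos (Real.pi / 2 * (2 - -lam)), ?_, ?_, 1, zero_le_one, fun t ht htre => ?_⟩
    · rw [neg_pos]
      exact Real.cos_neg_of_pi_div_two_lt_of_lt (by nlinarith) (by nlinarith)
    · linarith [Real.neg_one_le_cos (Real.pi / 2 * (2 - -lam))]
    · rw [neg_neg] at htre
      have h1 := cpow_re_nonneg_of_sector (m := -lam) (by linarith) (by linarith)
        (norm_pos_iff.1 (hc.trans_le ht)) htre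
      rw [Complex.ofReal_neg] at h1
      rw [Complex.norm_exp, Complex.re_ofReal_mul]
      exact Real.exp_le_one_iff.2 (mul_nonpos_of_nonpos_of_nonneg hz h1)

open MeasureTheory in
theorem wrightKernel_vertical {lam mu z c : ℝ} (hlam : -1 < lam) (hmu : 2 ≤ mu) (hz : z ≤ 0)
    (hc : 0 < c) :
    Integrable (fun y : ℝ => wrightKernel lam mu z (c + y * Complex.I)) ∧
    ((2 * Real.pi * wrightW lam mu z : ℝ) : ℂ) =
      ∫ y : ℝ, wrightKernel lam mu z (c + y * Complex.I) := by
  obtain ⟨d, hd0, hd, C, hC0, hC⟩ := exists_norm_exp_cpow_le hlam hz (half_pos hc)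
  have hbound : ∀ (t : ℂ) (y : ℝ), t.re ≤ c → c / 2 ≤ ‖t‖ → |y| ≤ ‖t‖ → -d * ‖t‖ ≤ t.re →
      ‖wrightKernel lam mu z t‖ ≤
        Real.exp c * C * ((c / 2) ^ (-(mu - 2)) * (1 + ((c / 2) ^ 2)⁻¹)) * (1 + y ^ 2)⁻¹ := by
    intro t y h1 h2 h3 h4
    have h5 := rpow_neg_le_of_le (half_pos hc) hmu h2 h3
    rw [norm_wrightKernel, mul_assoc (Real.exp c * C)]
    gcongr
    exact hC t h2 h4
  have hB : ∀ e, 0 ≤ e → e ≤ d → ∀ y, 0 ≤ y → ‖wrightKernel lam mu z (rayPoint c e y)‖ ≤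
        Real.exp c * C * ((c / 2) ^ (-(mu - 2)) * (1 + ((c / 2) ^ 2)⁻¹)) * (1 + y ^ 2)⁻¹ := by
    intro e he he' y hy
    have h1 := abs_le_norm_rayPoint c e y
    rw [abs_of_nonneg hy] at h1
    refine hbound _ _ ?_ (half_le_norm_rayPoint (he'.trans hd) hy) (abs_le_norm_rayPoint c e y) ?_
    · rw [rayPoint_re]; nlinarith
    · rw [rayPoint_re]; nlinarith
  have hint : Integrable (fun y : ℝ => wrightKernel lam mu z (c + y * Complex.I)) := by
    refine (integrable_const_mul_inv_one_add_sq _).mono' ?_ (Eventually.of_forall fun y =>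
      hbound _ y (by simp) ((half_le_self hc.le).trans (le_norm_add_mul_I c y))
        (abs_le_norm_add_mul_I c y) ?_)
    · refine Continuous.aestronglyMeasurable ?_
      exact (differentiableOn_wrightKernel lam mu z).continuousOn.comp_continuous (by fun_prop)
        fun y => Or.inl (by simpa using hc)
    · have : 0 ≤ d * ‖(c + y * Complex.I : ℂ)‖ := by positivity
      simp only [Complex.add_re, Complex.ofReal_re, Complex.mul_re, Complex.I_re, mul_zero,
        Complex.ofReal_im, Complex.I_im, mul_one, sub_self, add_zero]
      linarith
  refine ⟨hint, ?_⟩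
  have hW : wrightW lam mu z = _ := (hasSum_wright hlam hc hd0 hd mu z).tsum_eq
  -- The series is known to equal the ray integral; with quadratic decay on all intermediate rays,
  -- it moves back to the vertical.
  rw [integral_rayPoint_eq_vertical hc hd0.le hd (differentiableOn_wrightKernel lam mu z) hB,
    integral_mul_const, Complex.mul_I_im] at hW
  rw [integral_eq_two_mul_re_of_conj hint, hW]
  · have hray : ∀ y : ℝ, rayPoint c 0 y = c + y * Complex.I := fun y => by simp [rayPoint]
    simp only [hray]
    have hX : ∀ X : ℝ, 2 * Real.pi * (X / Real.pi) = 2 * X := fun X => by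
      have := Real.pi_ne_zero
      field_simp
    rw [hX]
  · intro y
    have hc' : (c + y * Complex.I : ℂ).arg ≠ Real.pi :=
      Complex.slitPlane_arg_ne_pi (Or.inl (by simpa using hc))
    have e : (c + ((-y : ℝ) : ℂ) * Complex.I : ℂ) = (starRingEnd ℂ) (c + y * Complex.I) := by
      simp
    simp only [wrightKernel]
    rw [e]
    generalize (c + y * Complex.I : ℂ) = t at hc'
    rw [map_mul, ← Complex.exp_conj, map_add, map_mul, Complex.conj_cpow _ _ hc',
      Complex.conj_cpow _ _ hc']
    simp

theorem summable_wright {lam : ℝ} (hlam : -1 < lam) (mu z : ℝ) :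
    Summable fun n : ℕ => z ^ n / ((n.factorial : ℝ) * Real.Gamma (lam * n + mu)) :=
  (hasSum_wright hlam one_pos one_pos le_rfl mu z).summable

/-! ### Real saddle points -/

theorem hasDerivAt_saddleFun (lam u : ℝ) :
    HasDerivAt (fun u : ℝ => Real.exp u + lam * Real.exp (-lam * u))
      (Real.exp u - lam ^ 2 * Real.exp (-lam * u)) u := by
  have h := (Real.hasDerivAt_exp u).add ((((hasDerivAt_id u).const_mul (-lam)).exp).const_mul lam)
  refine h.congr_deriv ?_
  simp only [id]
  ring

theorem continuous_saddleFun (lam : ℝ) :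
    Continuous fun u : ℝ => Real.exp u + lam * Real.exp (-lam * u) := by fun_prop

/-- The left side factors as `e^(-λu) (e^((1+λ)u) + λ)` with both factors increasing. The second is
positive at a root, so the product exceeds `2a` strictly to the right of any root. -/
theorem realSaddles_of_neg {lam a : ℝ} (ha : 0 < a) (h1 : -1 < lam) (h2 : lam < 0) :
    ∃ u0, realSaddles lam a = {u0} := by
  have hfac : ∀ u, Real.exp u + lam * Real.exp (-lam * u) =
      Real.exp (-lam * u) * (Real.exp ((1 + lam) * u) + lam) := fun u => by
    rw [mul_add, ← Real.exp_add]; ring_nf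
  have hex : ∃ u, Real.exp u + lam * Real.exp (-lam * u) = 2 * a := by
    refine mem_range_of_exists_le_of_exists_ge (continuous_saddleFun lam)
      ⟨Real.log (2 * a), ?_⟩ ⟨max 0 (Real.log (2 * a / (1 + lam))), ?_⟩
    · rw [Real.exp_log (by positivity)]
      nlinarith [Real.exp_pos (-lam * Real.log (2 * a))]
    -- For `v ≥ 0` one has `e^(-λv) ≤ e^v`, so the left side is at least `(1+λ) e^v ≥ 2a`.
    · set v := max 0 (Real.log (2 * a / (1 + lam)))
      have hv0 : 0 ≤ v := le_max_left _ _
      have hv : 2 * a / (1 + lam) ≤ Real.exp v := by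
        rw [← Real.log_le_iff_le_exp (div_pos (by linarith) (by linarith))]
        exact le_max_right _ _
      rw [div_le_iff₀ (by linarith)] at hv
      have h3 : Real.exp (-lam * v) ≤ Real.exp v := by gcongr; nlinarith
      nlinarith
  obtain ⟨u0, hu0⟩ := hex
  have hlt : ∀ u v, Real.exp u + lam * Real.exp (-lam * u) = 2 * a → u < v →
      2 * a < Real.exp v + lam * Real.exp (-lam * v) := by
    intro u v hu huv
    rw [hfac] at hu ⊢
    have hp : 0 < Real.exp ((1 + lam) * u) + lam := by
      by_contra! h
      nlinarith [Real.exp_pos (-lam * u)]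
    have h3 : Real.exp (-lam * u) < Real.exp (-lam * v) := 
      Real.exp_lt_exp.2 (by nlinarith)
    have h4 : Real.exp ((1 + lam) * u) < Real.exp ((1 + lam) * v) :=
      Real.exp_lt_exp.2 (by nlinarith)
    rw [← hu]
    have := Real.exp_pos (-lam * u)
    nlinarith
  refine ⟨u0, Set.ext fun v => ⟨fun hv => ?_, fun hv => ?_⟩⟩
  · rcases lt_trichotomy u0 v with h | h | h
    · exact absurd hv (hlt u0 v hu0 h).ne'
    · exact h.symm
    · exact absurd hu0 (hlt v u0 hv h).ne'
  · rw [Set.mem_singleton_iff.1 hv]; exact hu0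

/-- The left side decreases up to `us = 2 log λ / (1+λ)` and increases afterwards, with infinite
limits at both ends. Its minimum is `(1+λ) λ^((1-λ)/(1+λ))`, so the hypothesis on `a` says exactly
that the level `2a` lies above it. The last inequality is `h''(u₀) > 0`. -/
theorem realSaddles_of_pos {lam a : ℝ} (h0 : 0 < lam)
    (ha : (1 / 2 : ℝ) * (1 + lam) * lam ^ ((1 - lam) / (1 + lam)) < a) :
    ∃ u1 u0, u1 < u0 ∧ realSaddles lam a = {u1, u0} ∧
      lam ^ 2 * Real.exp (-lam * u0) < Real.exp u0 := by
  set p := Real.log lam * ((1 - lam) / (1 + lam)) with hp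
  set us := 2 * Real.log lam / (1 + lam) with hus
  set f : ℝ → ℝ := fun u => Real.exp u + lam * Real.exp (-lam * u) with hf
  have hl : Real.exp (Real.log lam) = lam := Real.exp_log h0
  have hder : ∀ u, Real.exp u - lam ^ 2 * Real.exp (-lam * u) =
      Real.exp (-lam * u) * (Real.exp ((1 + lam) * u) - Real.exp ((1 + lam) * us)) := fun u => by
    have e1 : (1 + lam) * us = Real.log lam + Real.log lam := by
      rw [hus]; field_simp; ring
    rw [e1, Real.exp_add (Real.log lam), hl, mul_sub, ← Real.exp_add]
    ring_nf
  have hmin : f us < 2 * a := by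
    have e1 : Real.exp us = lam * Real.exp p := by
      have : us = Real.log lam + p := by rw [hp, hus]; field_simp; ring
      rw [this, Real.exp_add, hl]
    have e2 : lam * Real.exp (-lam * us) = Real.exp p := by
      have : p = Real.log lam + -lam * us := by rw [hp, hus]; field_simp; ring
      rw [this, Real.exp_add, hl]
    rw [Real.rpow_def_of_pos h0] at ha
    simp only [hf]
    rw [e1, e2]
    linarith
  have hmono : StrictMonoOn f (Set.Ici us) := by
    refine strictMonoOn_of_deriv_pos (convex_Ici us) (continuous_saddleFun lam).continuousOn ?_
    intro u hu
    rw [interior_Ici] at hu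
    rw [(hasDerivAt_saddleFun lam u).deriv, hder]
    refine mul_pos (Real.exp_pos _) (sub_pos.2 (Real.exp_lt_exp.2 ?_))
    have : us < u := hu
    gcongr
  have hanti : StrictAntiOn f (Set.Iic us) := by
    refine strictAntiOn_of_deriv_neg (convex_Iic us) (continuous_saddleFun lam).continuousOn ?_
    intro u hu
    rw [interior_Iic] at hu
    rw [(hasDerivAt_saddleFun lam u).deriv, hder]
    refine mul_neg_of_pos_of_neg (Real.exp_pos _) (sub_neg.2 (Real.exp_lt_exp.2 ?_))
    have : u < us := hu
    gcongr
  have htop : Tendsto f atTop atTop := by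
    refine tendsto_atTop_mono (fun u => ?_) Real.tendsto_exp_atTop
    have := Real.exp_pos (-lam * u)
    simp only [hf]
    nlinarith
  have hbot : Tendsto f atBot atTop := by
    have h1 : Tendsto (fun u : ℝ => lam * Real.exp (-lam * u)) atBot atTop :=
      (Real.tendsto_exp_atTop.comp (tendsto_id.const_mul_atBot_of_neg (by linarith))).const_mul_atTop
        h0
    refine tendsto_atTop_mono (fun u => ?_) h1
    have := Real.exp_pos u
    simp only [hf]
    linarith
  obtain ⟨v, hv, hvus⟩ := ((htop.eventually_ge_atTop (2 * a)).and (eventually_ge_atTop us)).exists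
  obtain ⟨w, hw, hwus⟩ := ((hbot.eventually_ge_atTop (2 * a)).and (eventually_le_atBot us)).exists
  obtain ⟨u0, hu0, hfu0⟩ := intermediate_value_Icc hvus (continuous_saddleFun lam).continuousOn
    ⟨hmin.le, hv⟩
  obtain ⟨u1, hu1, hfu1⟩ := intermediate_value_Icc' hwus (continuous_saddleFun lam).continuousOn
    ⟨hmin.le, hw⟩
  have hlt0 : us < u0 := hu0.1.lt_of_ne fun h => by
    rw [← h] at hfu0; exact hmin.ne hfu0
  have hlt1 : u1 < us := hu1.2.lt_of_ne fun h => by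
    rw [h] at hfu1; exact hmin.ne hfu1
  refine ⟨u1, u0, hlt1.trans hlt0, Set.ext fun u => ⟨fun hu => ?_, ?_⟩, ?_⟩
  · have hu' : f u = 2 * a := hu
    rcases le_total us u with h | h
    · exact Or.inr (hmono.injOn h hlt0.le (hu'.trans hfu0.symm))
    · exact Or.inl (hanti.injOn h hlt1.le (hu'.trans hfu1.symm))
  · rintro (h | h)
    · rw [h]; exact hfu1
    · rw [Set.mem_singleton_iff.1 h]; exact hfu0
  · rw [← sub_pos, hder]
    refine mul_pos (Real.exp_pos _) (sub_pos.2 (Real.exp_lt_exp.2 ?_))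
    gcongr

/-! ### Derivatives of the phase -/

theorem iteratedDeriv_phase (lam a : ℝ) (n : ℕ) :
    iteratedDeriv (n + 2) (phase lam a) = fun u =>
      (Real.exp u - (-lam) ^ (n + 2) * Real.exp (-lam * u)) / 2 := by
  have hexp : ∀ u, HasDerivAt (fun u => Real.exp (-lam * u)) (-lam * Real.exp (-lam * u)) u :=
    fun u => (((hasDerivAt_id u).const_mul (-lam)).exp).congr_deriv (by simp only [id]; ring)
  induction n with
  | zero =>
    have h1 : deriv (phase lam a) =
        fun u => (Real.exp u - (-lam) * Real.exp (-lam * u)) / 2 - a := by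
      ext u
      exact ((((Real.hasDerivAt_exp u).sub (hexp u)).div_const 2).sub
        (((hasDerivAt_id u).const_mul a))).deriv.trans (by ring)
    rw [zero_add, iteratedDeriv_succ, iteratedDeriv_one, h1]
    ext u
    exact ((((Real.hasDerivAt_exp u).sub ((hexp u).const_mul (-lam))).div_const 2).sub_const
      a).deriv.trans (by ring)
  | succ n ih =>
    rw [iteratedDeriv_succ, ih]
    ext u
    exact (((Real.hasDerivAt_exp u).sub ((hexp u).const_mul _)).div_const 2).deriv.trans (by ring)

theorem hasDerivAt_cexp_const_mul (k u : ℂ) :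
    HasDerivAt (fun u => Complex.exp (k * u)) (k * Complex.exp (k * u)) u :=
  (((hasDerivAt_id u).const_mul k).cexp).congr_deriv (by simp only [id]; ring)

theorem hasDerivAt_phaseC (lam a : ℝ) (u : ℂ) : HasDerivAt (phaseC lam a)
    ((Complex.exp u + lam * Complex.exp (-(lam : ℂ) * u)) / 2 - a) u :=
  ((((Complex.hasDerivAt_exp u).sub (hasDerivAt_cexp_const_mul (-lam) u)).div_const 2).sub
    (((hasDerivAt_id u).const_mul (a : ℂ)))).congr_deriv (by ring)

theorem iteratedDeriv_phaseC (lam a : ℝ) (n : ℕ) :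
    iteratedDeriv (n + 2) (phaseC lam a) = fun u =>
      (Complex.exp u - (-(lam : ℂ)) ^ (n + 2) * Complex.exp (-(lam : ℂ) * u)) / 2 := by
  induction n with
  | zero =>
    rw [zero_add, iteratedDeriv_succ, iteratedDeriv_one,
      funext fun u => (hasDerivAt_phaseC lam a u).deriv]
    ext u
    exact ((((Complex.hasDerivAt_exp u).add ((hasDerivAt_cexp_const_mul (-lam) u).const_mul
      (lam : ℂ))).div_const 2).sub_const (a : ℂ)).deriv.trans (by ring)
  | succ n ih =>
    rw [iteratedDeriv_succ, ih]
    ext u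
    exact (((Complex.hasDerivAt_exp u).sub ((hasDerivAt_cexp_const_mul (-lam) u).const_mul
      _)).div_const 2).deriv.trans (by ring)

theorem iteratedDeriv_phaseC_ofReal (lam a u0 : ℝ) {n : ℕ} (hn : 2 ≤ n) :
    iteratedDeriv n (phaseC lam a) u0 = (phaseDeriv lam a u0 n : ℂ) := by
  obtain ⟨k, rfl⟩ := Nat.exists_eq_add_of_le' hn
  rw [phaseDeriv, iteratedDeriv_phase, iteratedDeriv_phaseC]
  push_cast
  rfl

theorem phaseDeriv_eq {lam a u0 : ℝ} (h : Real.exp u0 + lam * Real.exp (-lam * u0) = 2 * a)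
    {n : ℕ} (hn : 2 ≤ n) : phaseDeriv lam a u0 n =
      (1 - (-lam) ^ (n - 1)) * Real.exp u0 / 2 + a * (-lam) ^ (n - 1) := by
  obtain ⟨k, rfl⟩ := Nat.exists_eq_add_of_le' hn
  rw [phaseDeriv, iteratedDeriv_phase, show k + 2 - 1 = k + 1 from rfl]
  linear_combination (-lam) ^ (k + 1) / 2 * h

theorem phaseDeriv_two_pos {lam a u0 : ℝ} (ha : 0 < a) (h1 : -1 < lam) (h2 : lam ≠ 0)
    (h : Real.exp u0 + lam * Real.exp (-lam * u0) = 2 * a)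
    (hpos : 0 < lam → lam ^ 2 * Real.exp (-lam * u0) < Real.exp u0) :
    0 < phaseDeriv lam a u0 2 := by
  rw [phaseDeriv, iteratedDeriv_phase lam a 0]
  simp only [zero_add, neg_sq]
  refine half_pos (sub_pos.2 ?_)
  rcases lt_or_gt_of_ne h2 with h3 | h3
  -- For `-1 < λ < 0` this gives `λ² e^(-λu₀) < -λ e^(-λu₀) = e^(u₀) - 2a < e^(u₀)`.
  · have h4 : lam ^ 2 < -lam := by nlinarith
    have := mul_lt_mul_of_pos_right h4 (Real.exp_pos (-lam * u0))
    linarith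
  · exact hpos h3

/-! ### Analytic square root and its inverse -/

open ComplexConjugate in
/-- Reversion of a function `Φ s = s ^ 2 + O(s ^ 3)`: an analytic square root `Ψ` of `Φ` and its
local inverse `S`. -/
theorem exists_sqrt_reversion {Φ : ℂ → ℂ} (hΦ : AnalyticAt ℂ Φ 0)
    (h3 : ∀ i < 3, iteratedDeriv i (fun s => Φ s - s ^ 2) 0 = 0)
    (hconj : ∀ s, Φ (conj s) = conj (Φ s)) :
    ∃ Ψ S : ℂ → ℂ, AnalyticAt ℂ Ψ 0 ∧ AnalyticAt ℂ S 0 ∧ Ψ 0 = 0 ∧ S 0 = 0 ∧ deriv Ψ 0 = 1 ∧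
      deriv S 0 = 1 ∧ (∀ᶠ s in 𝓝 0, Ψ s ^ 2 = Φ s) ∧ (∀ᶠ s in 𝓝 0, S (Ψ s) = s) ∧
      (∀ᶠ r in 𝓝 0, Ψ (S r) = r) ∧ ∀ᶠ r in 𝓝 0, S (conj r) = conj (S r) := by
  obtain ⟨g, hg, hgΦ⟩ := (natCast_le_analyticOrderAt (n := 3)
    (show AnalyticAt ℂ (fun s => Φ s - s ^ 2) 0 by fun_prop)).1
    ((natCast_le_analyticOrderAt_iff_iteratedDeriv_eq_zero (by fun_prop)).2 h3)
  -- `Φ = s² q` with `q 0 = 1`, so `Ψ = s √q` with the principal root is analytic and `Ψ' 0 = 1`.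
  -- The conjugation symmetry of `Φ` passes to `q`, `Ψ` and `S`; it makes the Taylor coefficients of
  -- `S` real.
  set q : ℂ → ℂ := fun s => 1 + s * g s with hq
  have hqa : AnalyticAt ℂ q 0 := by fun_prop
  have hq0 : q 0 = 1 := by simp [hq]
  have hqΦ : ∀ᶠ s in 𝓝 0, Φ s = s ^ 2 * q s := by
    filter_upwards [hgΦ] with s hs
    rw [sub_zero, smul_eq_mul] at hs
    simp only [hq]
    linear_combination hs
  have hsl : ∀ᶠ s in 𝓝 0, q s ∈ Complex.slitPlane :=
    hqa.continuousAt.eventually_mem (Complex.isOpen_slitPlane.mem_nhds (by simp [hq0]))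
  have hconj0 : Tendsto (fun s : ℂ => conj s) (𝓝 0) (𝓝 0) := by
    simpa using (Complex.continuous_conj.tendsto (0 : ℂ))
  have hqconj : ∀ᶠ s in 𝓝 0, q (conj s) = conj (q s) := by
    filter_upwards [hqΦ, hconj0.eventually hqΦ] with s h1 h2
    rcases eq_or_ne s 0 with rfl | hs
    · simp [hq0]
    · have h3 : (conj s) ^ 2 * q (conj s) = (conj s) ^ 2 * conj (q s) := by
        rw [← h2, hconj, h1, map_mul, map_pow]
      exact mul_left_cancel₀ (pow_ne_zero 2 (by simpa using hs)) h3
  set Ψ : ℂ → ℂ := fun s => s * q s ^ ((1 / 2 : ℝ) : ℂ) with hΨ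
  have hΨa : AnalyticAt ℂ Ψ 0 := by
    refine analyticAt_id.mul (hqa.cpow analyticAt_const ?_)
    simp [hq0]
  have hΨ0 : Ψ 0 = 0 := by simp [hΨ]
  have hΨd : deriv Ψ 0 = 1 := by
    have h1 : DifferentiableAt ℂ (fun s => q s ^ ((1 / 2 : ℝ) : ℂ)) 0 :=
      (hqa.cpow analyticAt_const (by simp [hq0])).differentiableAt
    have h2 := ((hasDerivAt_id (0 : ℂ)).mul h1.hasDerivAt).deriv
    simp only [id, zero_mul, add_zero, one_mul, hq0, Complex.one_cpow] at h2
    exact h2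
  have hne : deriv Ψ 0 ≠ 0 := by simp [hΨd]
  have hSa := hΨa.analyticAt_localInverse hne
  have hleft := hΨa.hasStrictDerivAt.eventually_left_inverse hne
  have hright := hΨa.hasStrictDerivAt.eventually_right_inverse hne
  have hSd := (hΨa.hasStrictDerivAt.to_localInverse hne).hasDerivAt.deriv
  set S := hΨa.hasStrictDerivAt.localInverse _ _ _ hne
  have hS0 : S 0 = 0 := by simpa [hΨ0] using hleft.self_of_nhds
  rw [hΨ0] at hSa hright hSd
  refine ⟨Ψ, S, hΨa, hSa, hΨ0, hS0, hΨd, by simpa [hΨd] using hSd, ?_, hleft, hright, ?_⟩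
  · filter_upwards [hqΦ] with s hs
    rw [hs, hΨ, mul_pow, ← Complex.cpow_nat_mul]
    norm_num
  · have hS : Tendsto S (𝓝 0) (𝓝 0) := by simpa [hS0] using hSa.continuousAt.tendsto
    filter_upwards [hright, hS.eventually hqconj, hS.eventually hsl,
      hS.eventually (hconj0.eventually hleft)] with r h1 h2 h4 h5
    have h6 : Ψ (conj (S r)) = conj (Ψ (S r)) := by
      simp only [hΨ]
      rw [h2, map_mul, Complex.conj_cpow _ _ (Complex.slitPlane_arg_ne_pi h4), Complex.conj_ofReal]
    rw [h1] at h6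
    rw [← h6, h5]

open ComplexConjugate in
theorem conj_iteratedDeriv_of_conj {S : ℂ → ℂ} (h : ∀ᶠ r in 𝓝 0, S (conj r) = conj (S r)) (n : ℕ) :
    conj (iteratedDeriv n S 0) = iteratedDeriv n S 0 := by
  have key : ∀ᶠ r in 𝓝 0, iteratedDeriv n S (conj r) = conj (iteratedDeriv n S r) := by
    induction n with
    | zero => simpa using h
    | succ n ih =>
      have h1 : iteratedDeriv n S =ᶠ[𝓝 0] conj ∘ iteratedDeriv n S ∘ conj := by
        filter_upwards [ih] with r hr
        simp [hr]
      filter_upwards [h1.deriv] with r hr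
      rw [iteratedDeriv_succ, hr, deriv_conj_conj]
      simp
  simpa using key.self_of_nhds.symm

/-! ### Calculus of jets -/

/-- `f r = ∑_{k < n} F_k r ^ k + O(r ^ n)` as `r → 0`. -/
def HasJet (n : ℕ) (f : ℂ → ℂ) (F : PowerSeries ℂ) : Prop :=
  (fun r => f r - (F.trunc n).eval r) =O[𝓝 0] fun r => r ^ n

theorem isBigO_eval_of_X_pow_dvd {p : Polynomial ℂ} {n : ℕ} (h : Polynomial.X ^ n ∣ p) :
    (fun r => p.eval r) =O[𝓝 0] fun r : ℂ => r ^ n := by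
  obtain ⟨q, rfl⟩ := h
  simp only [Polynomial.eval_mul, Polynomial.eval_pow, Polynomial.eval_X]
  have : (fun r : ℂ => q.eval r) =O[𝓝 0] fun _ => (1 : ℂ) :=
    (q.continuous.tendsto 0).isBigO_one ℂ
  simpa using (isBigO_refl (fun r : ℂ => r ^ n) (𝓝 0)).mul this

/-- A lowest nonzero coefficient of degree `k < n` would survive division by `r^k` as `r → 0`. -/
theorem X_pow_dvd_of_isBigO_eval {p : Polynomial ℂ} {n : ℕ}
    (h : (fun r => p.eval r) =O[𝓝 0] fun r : ℂ => r ^ n) : Polynomial.X ^ n ∣ p := by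
  rw [Polynomial.X_pow_dvd_iff]
  by_contra! hex
  classical
  have hk := Nat.find_spec hex
  have hmin := fun d (hd : d < Nat.find hex) => Nat.find_min hex hd
  set k := Nat.find hex
  obtain ⟨q, hq⟩ : Polynomial.X ^ k ∣ p := Polynomial.X_pow_dvd_iff.2 fun d hd => by
    by_contra h0
    exact hmin d hd ⟨hd.trans hk.1, h0⟩
  have hq0 : q.eval 0 ≠ 0 := by
    have e : (Polynomial.X ^ k * q).coeff k = q.coeff 0 := by
      simpa using Polynomial.coeff_X_pow_mul q k 0
    rw [← Polynomial.coeff_zero_eq_eval_zero, ← e, ← hq]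
    exact hk.2
  have h1 : (fun r : ℂ => q.eval r) =O[𝓝[≠] 0] fun r : ℂ => r ^ (n - k) := by
    have h2 := (h.mono nhdsWithin_le_nhds).mul
      (isBigO_refl (fun r : ℂ => (r ^ k)⁻¹) (𝓝[≠] 0))
    refine h2.congr' ?_ ?_
    · filter_upwards [self_mem_nhdsWithin] with r hr
      have : r ≠ 0 := hr
      rw [hq, Polynomial.eval_mul, Polynomial.eval_pow, Polynomial.eval_X]
      field_simp
    · filter_upwards [self_mem_nhdsWithin] with r hr
      rw [pow_sub₀ _ hr hk.1.le]
  have h3 : Tendsto (fun r : ℂ => r ^ (n - k)) (𝓝[≠] 0) (𝓝 0) := by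
    have : Tendsto (fun r : ℂ => r ^ (n - k)) (𝓝 0) (𝓝 (0 ^ (n - k))) :=
      (continuous_pow _).tendsto 0
    rw [zero_pow (Nat.sub_pos_of_lt hk.1).ne'] at this
    exact this.mono_left nhdsWithin_le_nhds
  exact hq0 (tendsto_nhds_unique ((q.continuous.tendsto 0).mono_left nhdsWithin_le_nhds)
    (h1.trans_tendsto h3))

namespace HasJet

variable {n : ℕ} {f g : ℂ → ℂ} {F G : PowerSeries ℂ}

/-- Uniqueness of jets turns an identity of functions near `0` into identities of coefficients. It
is used to compare two expansions of `Φ ∘ S`. -/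
theorem coeff_eq (hF : HasJet n f F) (hG : HasJet n f G) {k : ℕ} (hk : k < n) :
    F.coeff k = G.coeff k := by
  have h : (fun r => (G.trunc n - F.trunc n).eval r) =O[𝓝 0] fun r : ℂ => r ^ n :=
    (IsBigO.sub hF hG).congr_left fun r => by simp
  have := Polynomial.X_pow_dvd_iff.1 (X_pow_dvd_of_isBigO_eval h) k hk
  rw [Polynomial.coeff_sub, PowerSeries.coeff_trunc, PowerSeries.coeff_trunc, if_pos hk, if_pos hk]
    at this
  exact (sub_eq_zero.1 this).symm

theorem isBigO_one (hF : HasJet n f F) : f =O[𝓝 0] fun _ => (1 : ℂ) := by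
  have h1 : (fun r : ℂ => (F.trunc n).eval r) =O[𝓝 0] fun _ => (1 : ℂ) :=
    ((F.trunc n).continuous.tendsto 0).isBigO_one ℂ
  have h2 : (fun r : ℂ => r ^ n) =O[𝓝 0] fun _ => (1 : ℂ) :=
    ((continuous_pow n).tendsto (0 : ℂ)).isBigO_one ℂ
  exact ((hF.trans h2).add h1).congr_left fun r => by simp

theorem mul (hF : HasJet n f F) (hG : HasJet n g G) : HasJet n (fun r => f r * g r) (F * G) := by
  have h1 := hF.isBigO_one.mul hG
  have h2 := IsBigO.mul hF (((G.trunc n).continuous.tendsto 0).isBigO_one ℂ)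
  have h3 : (fun r => (F.trunc n * G.trunc n - (F * G).trunc n).eval r) =O[𝓝 0]
      fun r : ℂ => r ^ n := by
    refine isBigO_eval_of_X_pow_dvd (Polynomial.X_pow_dvd_iff.2 fun d hd => ?_)
    rw [Polynomial.coeff_sub, PowerSeries.coeff_trunc, if_pos hd,
      PowerSeries.coeff_mul_eq_coeff_trunc_mul_trunc _ _ hd, ← Polynomial.coe_mul,
      Polynomial.coeff_coe, sub_self]
  refine (((h1.congr_right fun r => one_mul _).add (h2.congr_right fun r => mul_one _)).add
    h3).congr_left fun r => ?_
  simp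
  ring

theorem add (hF : HasJet n f F) (hG : HasJet n g G) : HasJet n (fun r => f r + g r) (F + G) :=
  (IsBigO.add hF hG).congr_left fun r => by simp; ring

theorem const (n : ℕ) (c : ℂ) : HasJet n (fun _ => c) (PowerSeries.C c) := by
  cases n with
  | zero => simpa [HasJet] using isBigO_const_const c (one_ne_zero' ℂ) (𝓝 0)
  | succ n =>
    simp only [HasJet, PowerSeries.trunc_C, Polynomial.eval_C, sub_self]
    exact isBigO_zero _ _

theorem pow (hF : HasJet n f F) (m : ℕ) : HasJet n (fun r => f r ^ m) (F ^ m) := by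
  induction m with
  | zero => simpa using const n 1
  | succ m ih => simpa only [pow_succ] using ih.mul hF

theorem sum {ι : Type*} (s : Finset ι) {f : ι → ℂ → ℂ} {F : ι → PowerSeries ℂ}
    (h : ∀ i ∈ s, HasJet n (f i) (F i)) : HasJet n (fun r => ∑ i ∈ s, f i r) (∑ i ∈ s, F i) := by
  classical
  induction s using Finset.induction_on with
  | empty => simpa using const n 0
  | insert i s hi ih =>
    simp only [Finset.sum_insert hi]
    exact (h i (by simp)).add (ih fun j hj => h j (by simp [hj]))

theorem congr (hF : HasJet n f F) (h : (fun r => g r - f r) =O[𝓝 0] fun r : ℂ => r ^ n) :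
    HasJet n g F :=
  (h.add hF).congr_left fun r => by ring

theorem of_polynomial (n : ℕ) (p : Polynomial ℂ) : HasJet n (fun r => p.eval r) p := by
  refine (isBigO_eval_of_X_pow_dvd (p := p - (p : PowerSeries ℂ).trunc n)
    (Polynomial.X_pow_dvd_iff.2 fun d hd => ?_)).congr_left fun r => by simp
  rw [Polynomial.coeff_sub, PowerSeries.coeff_trunc, if_pos hd, Polynomial.coeff_coe, sub_self]

end HasJet

theorem AnalyticAt.hasJet {f : ℂ → ℂ} (hf : AnalyticAt ℂ f 0) (n : ℕ) :
    HasJet n f (PowerSeries.mk fun k => iteratedDeriv k f 0 / k.factorial) := by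
  have h := (hf.hasFPowerSeriesAt.isBigO_sub_partialSum_pow n).norm_right
  refine IsBigO.of_norm_right ((h.congr_left fun r => ?_).congr_right fun r => ?_)
  · rw [zero_add]
    congr 1
    rw [Polynomial.eval, PowerSeries.eval₂_trunc_eq_sum_range]
    simp [FormalMultilinearSeries.partialSum, mul_comm]
  · simp

/-! ### Coefficients of the reversion -/

section CoeffMul

variable (F G : PowerSeries ℂ)

theorem coeff_mul_zero' : (F * G).coeff 0 = F.coeff 0 * G.coeff 0 := by
  simp

theorem coeff_mul_one' : (F * G).coeff 1 = F.coeff 0 * G.coeff 1 + F.coeff 1 * G.coeff 0 := by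
  rw [PowerSeries.coeff_mul, Finset.Nat.sum_antidiagonal_eq_sum_range_succ_mk]
  simp [Finset.sum_range_succ]

theorem coeff_mul_two' : (F * G).coeff 2 =
    F.coeff 0 * G.coeff 2 + F.coeff 1 * G.coeff 1 + F.coeff 2 * G.coeff 0 := by
  rw [PowerSeries.coeff_mul, Finset.Nat.sum_antidiagonal_eq_sum_range_succ_mk]
  simp [Finset.sum_range_succ]

theorem coeff_mul_three' : (F * G).coeff 3 = F.coeff 0 * G.coeff 3 + F.coeff 1 * G.coeff 2 +
    F.coeff 2 * G.coeff 1 + F.coeff 3 * G.coeff 0 := by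
  rw [PowerSeries.coeff_mul, Finset.Nat.sum_antidiagonal_eq_sum_range_succ_mk]
  simp [Finset.sum_range_succ]

theorem coeff_mul_four' : (F * G).coeff 4 = F.coeff 0 * G.coeff 4 + F.coeff 1 * G.coeff 3 +
    F.coeff 2 * G.coeff 2 + F.coeff 3 * G.coeff 1 + F.coeff 4 * G.coeff 0 := by
  rw [PowerSeries.coeff_mul, Finset.Nat.sum_antidiagonal_eq_sum_range_succ_mk]
  simp [Finset.sum_range_succ]

theorem coeff_mul_five' : (F * G).coeff 5 = F.coeff 0 * G.coeff 5 + F.coeff 1 * G.coeff 4 +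
    F.coeff 2 * G.coeff 3 + F.coeff 3 * G.coeff 2 + F.coeff 4 * G.coeff 1 +
    F.coeff 5 * G.coeff 0 := by
  rw [PowerSeries.coeff_mul, Finset.Nat.sum_antidiagonal_eq_sum_range_succ_mk]
  simp [Finset.sum_range_succ]

theorem coeff_mul_six' : (F * G).coeff 6 = F.coeff 0 * G.coeff 6 + F.coeff 1 * G.coeff 5 +
    F.coeff 2 * G.coeff 4 + F.coeff 3 * G.coeff 3 + F.coeff 4 * G.coeff 2 +
    F.coeff 5 * G.coeff 1 + F.coeff 6 * G.coeff 0 := by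
  rw [PowerSeries.coeff_mul, Finset.Nat.sum_antidiagonal_eq_sum_range_succ_mk]
  simp [Finset.sum_range_succ]

end CoeffMul

open PowerSeries in
/-- The first coefficients of the reversion `S = X * T` of
`S² + (h₃/3) S³ + (h₄/12) S⁴ + ⋯ + (h₈/20160) S⁸ = X²`. -/
theorem reversion_coeffs {h3 h4 h5 h6 h7 h8 : ℂ} {T : PowerSeries ℂ} (hT0 : T.coeff 0 = 1)
    (hE : ∀ j, j ≠ 0 → j < 7 → (T ^ 2 + C (h3 / 3) * (X ^ 1 * T ^ 3) + C (h4 / 12) * (X ^ 2 * T ^ 4) +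
      C (h5 / 60) * (X ^ 3 * T ^ 5) + C (h6 / 360) * (X ^ 4 * T ^ 6) +
      C (h7 / 2520) * (X ^ 5 * T ^ 7) + C (h8 / 20160) * (X ^ 6 * T ^ 8)).coeff j = 0) :
    T.coeff 2 = (5 * h3 ^ 2 - 3 * h4) / 72 ∧
    T.coeff 4 = (385 * h3 ^ 4 - 630 * h3 ^ 2 * h4 + 105 * h4 ^ 2 + 168 * h3 * h5 - 24 * h6) /
      17280 ∧
    T.coeff 6 = (425425 * h3 ^ 6 - 1126125 * h3 ^ 4 * h4 + 675675 * h3 ^ 2 * h4 ^ 2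
      - 51975 * h4 ^ 3 + 360360 * h3 ^ 3 * h5 - 249480 * h3 * h4 * h5 + 13608 * h5 ^ 2
      - 83160 * h3 ^ 2 * h6 + 22680 * h4 * h6 + 12960 * h3 * h7 - 1080 * h8) / 43545600 := by
  have e1 := hE 1 (by norm_num) (by norm_num)
  have e2 := hE 2 (by norm_num) (by norm_num)
  have e3 := hE 3 (by norm_num) (by norm_num)
  have e4 := hE 4 (by norm_num) (by norm_num)
  have e5 := hE 5 (by norm_num) (by norm_num)
  have e6 := hE 6 (by norm_num) (by norm_num)
  clear hE
  simp only [map_add, coeff_C_mul, coeff_X_pow_mul'] at e1 e2 e3 e4 e5 e6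
  norm_num only [if_true, if_false] at e1 e2 e3 e4 e5 e6
  have p2 : T ^ 2 = T * T := sq T
  have p3 : T ^ 3 = T ^ 2 * T := pow_succ T 2
  have p4 : T ^ 4 = T ^ 2 * T ^ 2 := by ring
  have p5 : T ^ 5 = T ^ 4 * T := pow_succ T 4
  have p6 : T ^ 6 = T ^ 4 * T ^ 2 := by ring
  have p7 : T ^ 7 = T ^ 6 * T := pow_succ T 6
  have p8 : T ^ 8 = T ^ 4 * T ^ 4 := by ring
  simp only [p8, p7, p6, p5, p4, p3, p2, coeff_mul_zero', coeff_mul_one', coeff_mul_two', coeff_mul_three', coeff_mul_four',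
    coeff_mul_five', coeff_mul_six', hT0, one_mul, mul_one] at e1 e2 e3 e4 e5 e6
  -- The system is triangular: in equation `j` the coefficient of index `j` enters only through
  -- `T²`, as `2 T_j`, and the others are already known. The odd ones are needed to reach the even
  -- ones.
  have t1 : T.coeff 1 = -h3 / 6 := by linear_combination e1 / 2
  rw [t1] at e2 e3 e4 e5 e6
  have t2 : T.coeff 2 = (5 * h3 ^ 2 - 3 * h4) / 72 := by linear_combination e2 / 2
  rw [t2] at e3 e4 e5 e6
  have t3 : T.coeff 3 = (-40 * h3 ^ 3 + 45 * h3 * h4 - 9 * h5) / 1080 := by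
    linear_combination e3 / 2
  rw [t3] at e4 e5 e6
  have t4 : T.coeff 4 = (385 * h3 ^ 4 - 630 * h3 ^ 2 * h4 + 105 * h4 ^ 2 + 168 * h3 * h5 -
      24 * h6) / 17280 := by linear_combination e4 / 2
  rw [t4] at e5 e6
  have t5 : T.coeff 5 = (-1960 * h3 ^ 5 + 4200 * h3 ^ 3 * h4 - 1260 * h3 ^ 2 * h5 -
      1575 * h3 * h4 ^ 2 + 252 * h3 * h6 + 378 * h4 * h5 - 27 * h7) / 136080 := by
    linear_combination e5 / 2
  rw [t5] at e6
  exact ⟨t2, t4, by linear_combination e6 / 2⟩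

/-! ### Reversion at the saddle point -/

/-- `Ψ` is an analytic square root of the normalized phase at the saddle point and `S` its local
inverse. -/
structure IsSaddleReversion (lam a u0 : ℝ) (Ψ S : ℂ → ℂ) : Prop where
  analyticAt_sqrt : AnalyticAt ℂ Ψ 0
  analyticAt : AnalyticAt ℂ S 0
  sqrt_zero : Ψ 0 = 0
  zero : S 0 = 0
  deriv_sqrt : deriv Ψ 0 = 1
  deriv_zero : deriv S 0 = 1
  sqrt_sq : ∀ᶠ s in 𝓝 0, (phaseDeriv lam a u0 2 : ℂ) / 2 * Ψ s ^ 2 =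
    phaseC lam a (u0 + s) - phaseC lam a u0
  left_inv : ∀ᶠ s in 𝓝 0, S (Ψ s) = s
  right_inv : ∀ᶠ r in 𝓝 0, Ψ (S r) = r
  real : ∀ n, (starRingEnd ℂ) (iteratedDeriv n S 0) = iteratedDeriv n S 0

/-- The phase at the saddle point, normalized to `s ^ 2 + O(s ^ 3)`. -/
def normalizedPhase (lam a u0 : ℝ) (s : ℂ) : ℂ :=
  2 / (phaseDeriv lam a u0 2 : ℂ) * (phaseC lam a (u0 + s) - phaseC lam a u0)

section Normalized

variable {lam a u0 : ℝ}

theorem analyticAt_normalizedPhase (s : ℂ) : AnalyticAt ℂ (normalizedPhase lam a u0) s := by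
  unfold normalizedPhase phaseC
  fun_prop

theorem normalizedPhase_zero : normalizedPhase lam a u0 0 = 0 := by simp [normalizedPhase]

theorem deriv_normalizedPhase : deriv (normalizedPhase lam a u0) =
    fun s => 2 / (phaseDeriv lam a u0 2 : ℂ) * deriv (phaseC lam a) (u0 + s) := by
  ext s
  unfold normalizedPhase
  rw [deriv_const_mul_field, deriv_sub_const, deriv_comp_const_add]

theorem deriv_phaseC_saddle (h : Real.exp u0 + lam * Real.exp (-lam * u0) = 2 * a) :
    deriv (phaseC lam a) u0 = 0 := by
  rw [(hasDerivAt_phaseC lam a u0).deriv]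
  have h' : Complex.exp u0 + lam * Complex.exp (-lam * u0) = 2 * a := by exact_mod_cast congrArg (fun x : ℝ => (x : ℂ)) h
  rw [h']
  ring

theorem iteratedDeriv_normalizedPhase {n : ℕ} (hn : n ≠ 0) (s : ℂ) :
    iteratedDeriv n (normalizedPhase lam a u0) s =
      2 / (phaseDeriv lam a u0 2 : ℂ) * iteratedDeriv n (phaseC lam a) (u0 + s) := by
  obtain ⟨k, rfl⟩ := Nat.exists_eq_succ_of_ne_zero hn
  rw [Nat.succ_eq_add_one, iteratedDeriv_succ', deriv_normalizedPhase,
    iteratedDeriv_const_mul_field, iteratedDeriv_comp_const_add, iteratedDeriv_succ']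

theorem iteratedDeriv_normalizedPhase_zero {n : ℕ} (hn : 2 ≤ n) :
    iteratedDeriv n (normalizedPhase lam a u0) 0 = 2 * (phaseRatio lam a u0 n : ℂ) := by
  rw [iteratedDeriv_normalizedPhase (by omega), add_zero, iteratedDeriv_phaseC_ofReal _ _ _ hn,
    phaseRatio]
  push_cast
  ring

theorem conj_phaseC (u : ℂ) :
    phaseC lam a ((starRingEnd ℂ) u) = (starRingEnd ℂ) (phaseC lam a u) := by
  simp [phaseC, ← Complex.exp_conj, map_ofNat]

theorem conj_normalizedPhase (s : ℂ) :
    normalizedPhase lam a u0 ((starRingEnd ℂ) s) = (starRingEnd ℂ) (normalizedPhase lam a u0 s) := by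
  have h1 : (u0 + (starRingEnd ℂ) s : ℂ) = (starRingEnd ℂ) (u0 + s) := by simp
  have h2 : (starRingEnd ℂ) (phaseC lam a u0) = phaseC lam a u0 := by
    rw [← conj_phaseC, Complex.conj_ofReal]
  simp only [normalizedPhase]
  rw [h1, conj_phaseC, map_mul, map_sub, h2]
  simp [map_ofNat]

theorem exists_isSaddleReversion (h : Real.exp u0 + lam * Real.exp (-lam * u0) = 2 * a)
    (h2 : 0 < phaseDeriv lam a u0 2) : ∃ Ψ S, IsSaddleReversion lam a u0 Ψ S := by
  have h2' : (phaseDeriv lam a u0 2 : ℂ) ≠ 0 := by exact_mod_cast h2.ne'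
  have hd1 : ∀ s, deriv (fun s => normalizedPhase lam a u0 s - s ^ 2) s =
      deriv (normalizedPhase lam a u0) s - 2 * s := fun s => by
    rw [deriv_fun_sub (analyticAt_normalizedPhase s).differentiableAt (by fun_prop)]
    simp
  have hΦ3 : ∀ i < 3, iteratedDeriv i (fun s => normalizedPhase lam a u0 s - s ^ 2) 0 = 0 := by
    intro i hi
    interval_cases i
    · simp [normalizedPhase_zero]
    · rw [iteratedDeriv_one, hd1, deriv_normalizedPhase]
      simp [deriv_phaseC_saddle h]
    · rw [iteratedDeriv_succ, iteratedDeriv_one, funext hd1,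
        deriv_fun_sub (analyticAt_normalizedPhase 0).deriv.differentiableAt (by fun_prop)]
      have h3 := iteratedDeriv_normalizedPhase_zero (lam := lam) (a := a) (u0 := u0) (le_refl 2)
      rw [iteratedDeriv_succ, iteratedDeriv_one] at h3
      rw [h3, phaseRatio, div_self h2.ne', deriv_const_mul_field, deriv_id'']
      simp
  obtain ⟨Ψ, S, h1, h2, h3, h4, h5, h6, h7, h8, h9, h10⟩ :=
    exists_sqrt_reversion (analyticAt_normalizedPhase (lam := lam) (a := a) (u0 := u0) 0) hΦ3
      conj_normalizedPhase
  refine ⟨Ψ, S, h1, h2, h3, h4, h5, h6, ?_, h8, h9, conj_iteratedDeriv_of_conj h10⟩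
  filter_upwards [h7] with s hs
  rw [hs, normalizedPhase]
  field_simp

end Normalized

/-- The coefficients of the even part of the derivative of the reversion. -/
def reversionCoeff (lam a u0 : ℝ) (S : ℂ → ℂ) (k : ℕ) : ℝ :=
  (iteratedDeriv (2 * k + 1) S 0).re / ((2 * k).factorial * phaseDeriv lam a u0 2 ^ k)

namespace IsSaddleReversion

variable {lam a u0 : ℝ} {Ψ S : ℂ → ℂ}

theorem iteratedDeriv_eq_re (hS : IsSaddleReversion lam a u0 Ψ S) (n : ℕ) :
    iteratedDeriv n S 0 = ((iteratedDeriv n S 0).re : ℂ) :=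
  (Complex.conj_eq_iff_re.1 (hS.real n)).symm

theorem coeffs (hS : IsSaddleReversion lam a u0 Ψ S)
    (h : Real.exp u0 + lam * Real.exp (-lam * u0) = 2 * a)
    (h2 : 0 < phaseDeriv lam a u0 2) {h3 h4 h5 h6 h7 h8 : ℂ}
    (e3 : h3 = phaseRatio lam a u0 3) (e4 : h4 = phaseRatio lam a u0 4)
    (e5 : h5 = phaseRatio lam a u0 5) (e6 : h6 = phaseRatio lam a u0 6)
    (e7 : h7 = phaseRatio lam a u0 7) (e8 : h8 = phaseRatio lam a u0 8) :
    iteratedDeriv 3 S 0 / 6 = (5 * h3 ^ 2 - 3 * h4) / 72 ∧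
    iteratedDeriv 5 S 0 / 120 =
      (385 * h3 ^ 4 - 630 * h3 ^ 2 * h4 + 105 * h4 ^ 2 + 168 * h3 * h5 - 24 * h6) / 17280 ∧
    iteratedDeriv 7 S 0 / 5040 =
      (425425 * h3 ^ 6 - 1126125 * h3 ^ 4 * h4 + 675675 * h3 ^ 2 * h4 ^ 2
      - 51975 * h4 ^ 3 + 360360 * h3 ^ 3 * h5 - 249480 * h3 * h4 * h5 + 13608 * h5 ^ 2
      - 83160 * h3 ^ 2 * h6 + 22680 * h4 * h6 + 12960 * h3 * h7 - 1080 * h8) / 43545600 := by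
  have h2' : (phaseDeriv lam a u0 2 : ℂ) ≠ 0 := by exact_mod_cast h2.ne'
  set T : PowerSeries ℂ := PowerSeries.mk fun k => iteratedDeriv (k + 1) S 0 / (k + 1).factorial
    with hT
  have hXT : PowerSeries.mk (fun k => iteratedDeriv k S 0 / k.factorial) = PowerSeries.X * T := by
    ext k
    cases k with
    | zero => simp [hS.zero]
    | succ k => rw [PowerSeries.coeff_succ_X_mul, hT, PowerSeries.coeff_mk, PowerSeries.coeff_mk]
  have hjS : HasJet 9 S (PowerSeries.X * T) := hXT ▸ hS.analyticAt.hasJet 9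
  set Φ := normalizedPhase lam a u0
  set φ : ℕ → ℂ := fun k => iteratedDeriv k Φ 0 / k.factorial with hφ
  -- Order 9 suffices: `A₃` needs `S` up to degree 7, hence `r²` compared with `Φ (S r)` up to
  -- degree 8. As `S r = O(r)`, the Taylor remainder of `Φ` is `O(r⁹)` after substitution.
  have hjet : HasJet 9 (fun r => Φ (S r))
      (∑ k ∈ Finset.range 9, PowerSeries.C (φ k) * (PowerSeries.X * T) ^ k) := by
    refine (HasJet.sum (Finset.range 9) fun k _ => (HasJet.const 9 (φ k)).mul (hjS.pow k)).congr ?_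
    have hS0 : Tendsto S (𝓝 0) (𝓝 0) := by
      simpa [hS.zero] using hS.analyticAt.continuousAt.tendsto
    have hSO : S =O[𝓝 0] fun r => r := by
      simpa [hS.zero] using hS.analyticAt.differentiableAt.isBigO_sub
    have hΦ9 : HasJet 9 Φ (PowerSeries.mk φ) := (analyticAt_normalizedPhase 0).hasJet 9
    refine ((IsBigO.comp_tendsto hΦ9 hS0).trans
      (hSO.pow 9)).congr_left fun r => ?_
    simp [Polynomial.eval, PowerSeries.eval₂_trunc_eq_sum_range]
  have hjet2 : HasJet 9 (fun r => Φ (S r)) (Polynomial.X ^ 2 : Polynomial ℂ) := by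
    refine (HasJet.of_polynomial 9 (Polynomial.X ^ 2)).congr ?_
    have hS0 : Tendsto S (𝓝 0) (𝓝 0) := by
      simpa [hS.zero] using hS.analyticAt.continuousAt.tendsto
    refine EventuallyEq.trans_isBigO (f₂ := fun _ => (0 : ℂ)) ?_ (isBigO_zero _ _)
    filter_upwards [hS.right_inv, hS0.eventually hS.sqrt_sq] with r h1 h3
    rw [h1] at h3
    simp only [Φ, normalizedPhase]
    rw [← h3]
    simp only [Polynomial.eval_pow, Polynomial.eval_X]
    field_simp
    ring
  have hφn : ∀ n, 2 ≤ n → φ n = 2 * (phaseRatio lam a u0 n : ℂ) / n.factorial := fun n hn => by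
    simp only [hφ, Φ]
    rw [iteratedDeriv_normalizedPhase_zero hn]
  have hφ0 : φ 0 = 0 := by simp [hφ, Φ, normalizedPhase_zero]
  have hφ1 : φ 1 = 0 := by
    simp only [hφ, Φ]
    rw [iteratedDeriv_one, deriv_normalizedPhase]
    simp [deriv_phaseC_saddle h]
  have hφ2 : φ 2 = 1 := by
    rw [hφn 2 le_rfl, phaseRatio, div_self h2.ne']; norm_num
  have hφ3 : φ 3 = h3 / 3 := by
    rw [hφn 3 (by norm_num), ← e3]; norm_num [Nat.factorial]; ring
  have hφ4 : φ 4 = h4 / 12 := by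
    rw [hφn 4 (by norm_num), ← e4]; norm_num [Nat.factorial]; ring
  have hφ5 : φ 5 = h5 / 60 := by
    rw [hφn 5 (by norm_num), ← e5]; norm_num [Nat.factorial]; ring
  have hφ6 : φ 6 = h6 / 360 := by
    rw [hφn 6 (by norm_num), ← e6]; norm_num [Nat.factorial]; ring
  have hφ7 : φ 7 = h7 / 2520 := by
    rw [hφn 7 (by norm_num), ← e7]; norm_num [Nat.factorial]; ring
  have hφ8 : φ 8 = h8 / 20160 := by
    rw [hφn 8 (by norm_num), ← e8]; norm_num [Nat.factorial]; ring
  have hT0 : T.coeff 0 = 1 := by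
    rw [hT, PowerSeries.coeff_mk, zero_add, iteratedDeriv_one, hS.deriv_zero]; simp
  have key := reversion_coeffs (h3 := h3) (h4 := h4) (h5 := h5) (h6 := h6) (h7 := h7) (h8 := h8)
    hT0 fun j hj0 hj => ?_
  · norm_num [hT, PowerSeries.coeff_mk, Nat.factorial] at key ⊢
    exact key
  · have h1 := hjet.coeff_eq hjet2 (k := j + 2) (by omega)
    rw [Polynomial.coeff_coe, Polynomial.coeff_X_pow, if_neg (by omega)] at h1
    rw [← h1, ← PowerSeries.coeff_X_pow_mul _ 2 j]
    congr 1
    simp only [Finset.sum_range_succ, Finset.sum_range_zero, hφ0, hφ1, hφ2, hφ3, hφ4, hφ5, hφ6,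
      hφ7, hφ8, map_zero, map_one]
    ring

theorem invSqrtNeg_sq (h2 : 0 < phaseDeriv lam a u0 2) :
    invSqrtNeg lam a u0 ^ 2 = -1 / (phaseDeriv lam a u0 2 : ℂ) := by
  rw [invSqrtNeg, div_pow, Complex.I_sq, ← Complex.ofReal_pow, Real.sq_sqrt h2.le]

/-- With `c = i/√h₀''` one has `c² = -1/h₀''`, so `r = c w` turns `(h₀''/2) r²` into `-w²/2`. -/
theorem isLocalReversion (hS : IsSaddleReversion lam a u0 Ψ S) (h2 : 0 < phaseDeriv lam a u0 2) :
    IsLocalReversion lam a u0 fun w => u0 + S (invSqrtNeg lam a u0 * w) := by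
  have h2' : (phaseDeriv lam a u0 2 : ℂ) ≠ 0 := by exact_mod_cast h2.ne'
  set c := invSqrtNeg lam a u0 with hc
  have hlin : Tendsto (fun w : ℂ => c * w) (𝓝 0) (𝓝 0) := by
    simpa using (continuous_const_mul c).tendsto (0 : ℂ)
  have hS0 : Tendsto S (𝓝 0) (𝓝 0) := by
    simpa [hS.zero] using hS.analyticAt.continuousAt.tendsto
  refine ⟨?_, by simp [hS.zero], ?_, ?_⟩
  · refine analyticAt_const.add (AnalyticAt.fun_comp ?_ (analyticAt_const.mul analyticAt_id))
    simpa using hS.analyticAt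
  · rw [deriv_const_add, deriv_comp_mul_left]
    simp [hS.deriv_zero, hc]
  · filter_upwards [hlin.eventually hS.right_inv, (hS0.comp hlin).eventually hS.sqrt_sq]
      with w h1 h3
    simp only [Function.comp] at h3
    rw [← h3, h1, mul_pow, hc, invSqrtNeg_sq h2]
    field_simp

theorem hasSum_deriv (hS : IsSaddleReversion lam a u0 Ψ S) (h2 : 0 < phaseDeriv lam a u0 2) :
    ∀ᶠ w in 𝓝 (0 : ℂ), HasSum (fun k : ℕ => invSqrtNeg lam a u0 *
      ((-1) ^ k * (reversionCoeff lam a u0 S k : ℂ) * w ^ (2 * k)))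
      ((deriv (fun w => u0 + S (invSqrtNeg lam a u0 * w)) w +
        deriv (fun w => u0 + S (invSqrtNeg lam a u0 * w)) (-w)) / 2) := by
  have h2' : (phaseDeriv lam a u0 2 : ℂ) ≠ 0 := by exact_mod_cast h2.ne'
  set c := invSqrtNeg lam a u0 with hc
  have hlin : Tendsto (fun w : ℂ => c * w) (𝓝 0) (𝓝 0) := by
    simpa using (continuous_const_mul c).tendsto (0 : ℂ)
  have hlin' : Tendsto (fun w : ℂ => c * -w) (𝓝 0) (𝓝 0) := by
    simpa [Function.comp_def] using ((continuous_const_mul c).comp continuous_neg).tendsto (0 : ℂ)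
  have hs := hS.analyticAt.deriv.hasFPowerSeriesAt.eventually_hasSum
  filter_upwards [hlin.eventually hs, hlin'.eventually hs] with w h1 h3
  rw [deriv_const_add, deriv_const_add, deriv_comp_mul_left, deriv_comp_mul_left]
  simp only [FormalMultilinearSeries.ofScalars_apply_eq, smul_eq_mul, zero_add] at h1 h3 ⊢
  have h4 := ((h1.add h3).div_const 2).mul_left c
  -- Odd powers cancel between `w` and `-w`, so the series is reindexed over even degrees; there
  -- `c^(2k) = (-1)^k / h₀''^k`.
  have hsupp : ∀ n ∉ Set.range (fun k : ℕ => 2 * k), c * ((iteratedDeriv n (deriv S) 0 /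
      n.factorial * (c * w) ^ n + iteratedDeriv n (deriv S) 0 / n.factorial * (c * -w) ^ n) / 2)
        = 0 := by
    intro n hn
    have hodd : Odd n := by
      rw [← Nat.not_even_iff_odd]
      rintro ⟨k, hk⟩
      exact hn ⟨k, by simp only; omega⟩
    rw [mul_neg, hodd.neg_pow]
    ring
  rw [← (mul_right_injective₀ (two_ne_zero' ℕ)).hasSum_iff hsupp] at h4
  convert! h4 using 1
  · ext k
    simp only [Function.comp]
    have hev : Even (2 * k) := even_two_mul k
    rw [mul_neg, hev.neg_pow, mul_pow, pow_mul c, hc, invSqrtNeg_sq h2, ← iteratedDeriv_succ',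
      hS.iteratedDeriv_eq_re, reversionCoeff, div_pow]
    push_cast
    field_simp
    ring
  · ring

theorem isReversionCoeffs (hS : IsSaddleReversion lam a u0 Ψ S) (h2 : 0 < phaseDeriv lam a u0 2) :
    IsReversionCoeffs lam a u0 (reversionCoeff lam a u0 S) :=
  ⟨_, hS.isLocalReversion h2, hS.hasSum_deriv h2⟩

theorem reversionCoeff_zero (hS : IsSaddleReversion lam a u0 Ψ S) :
    reversionCoeff lam a u0 S 0 = 1 := by
  simp [reversionCoeff, hS.deriv_zero]

theorem reversionCoeff_eq (hS : IsSaddleReversion lam a u0 Ψ S)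
    (h : Real.exp u0 + lam * Real.exp (-lam * u0) = 2 * a)
    {h2 h3 h4 h5 h6 h7 h8 : ℝ} (h2pos : 0 < h2) (e2 : h2 = phaseDeriv lam a u0 2)
    (e3 : h3 = phaseRatio lam a u0 3) (e4 : h4 = phaseRatio lam a u0 4)
    (e5 : h5 = phaseRatio lam a u0 5) (e6 : h6 = phaseRatio lam a u0 6)
    (e7 : h7 = phaseRatio lam a u0 7) (e8 : h8 = phaseRatio lam a u0 8) :
    reversionCoeff lam a u0 S 1 = (5 * h3 ^ 2 - 3 * h4) / (24 * h2) ∧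
    reversionCoeff lam a u0 S 2 =
      (385 * h3 ^ 4 - 630 * h3 ^ 2 * h4 + 105 * h4 ^ 2 + 168 * h3 * h5 - 24 * h6)
        / (3456 * h2 ^ 2) ∧
    reversionCoeff lam a u0 S 3 =
      (425425 * h3 ^ 6 - 1126125 * h3 ^ 4 * h4 + 675675 * h3 ^ 2 * h4 ^ 2
      - 51975 * h4 ^ 3 + 360360 * h3 ^ 3 * h5 - 249480 * h3 * h4 * h5
      + 13608 * h5 ^ 2 - 83160 * h3 ^ 2 * h6 + 22680 * h4 * h6
      + 12960 * h3 * h7 - 1080 * h8) / (6220800 * h2 ^ 3) := by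
  obtain ⟨k1, k2, k3⟩ := hS.coeffs h (e2 ▸ h2pos) (congrArg Complex.ofReal e3)
    (congrArg Complex.ofReal e4) (congrArg Complex.ofReal e5) (congrArg Complex.ofReal e6)
    (congrArg Complex.ofReal e7) (congrArg Complex.ofReal e8)
  rw [hS.iteratedDeriv_eq_re] at k1 k2 k3
  norm_cast at k1 k2 k3
  simp only [reversionCoeff, ← e2, mul_one, Nat.reduceMul, Nat.reduceAdd, pow_one, Nat.factorial,
    Nat.succ_eq_add_one, Nat.cast_ofNat, zero_add]
  refine ⟨?_, ?_, ?_⟩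
  -- `A_k` is `2k + 1` times the coefficient of `S` in degree `2k + 1`, divided by `h₀''^k`: thus
  -- `72/3 = 24`, `17280/5 = 3456`, `43545600/7 = 6220800`.
  · rw [div_eq_div_iff (by positivity) (by positivity)]
    linear_combination 144 * h2 * k1
  · rw [div_eq_div_iff (by positivity) (by positivity)]
    linear_combination 24 * 120 * 144 * h2 ^ 2 * k2
  · rw [div_eq_div_iff (by positivity) (by positivity)]
    linear_combination 5040 * 6220800 * h2 ^ 3 * k3

end IsSaddleReversion

/-! ### Gaussian moments and Laplace's method -/

theorem Gamma_nat_add_half (k : ℕ) :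
    Real.Gamma (k + 1 / 2) = poch (1 / 2) k * Real.sqrt Real.pi := by
  induction k with
  | zero => simpa [poch] using Real.Gamma_one_half_eq
  | succ k ih =>
    have h0 : (k + 1 / 2 : ℝ) ≠ 0 := by positivity
    rw [Nat.cast_succ, show (k + 1 + 1 / 2 : ℝ) = (k + 1 / 2) + 1 by ring, Real.Gamma_add_one h0, ih,
      poch, poch, ascPochhammer_succ_eval]
    ring

theorem poch_half_pos (k : ℕ) : 0 < poch (1 / 2) k :=
  ascPochhammer_pos k _ (by norm_num)

open MeasureTheory in
theorem integrable_pow_mul_gaussian {x : ℝ} (hx : 0 < x) (k : ℕ) :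
    Integrable fun w : ℝ => w ^ (2 * k) * Real.exp (-(x * w ^ 2 / 2)) := by
  have h := integrable_rpow_mul_exp_neg_mul_sq (half_pos hx) (s := (2 * k : ℕ))
    (by have : (0 : ℝ) ≤ (2 * k : ℕ) := by positivity
        linarith)
  refine h.congr (Eventually.of_forall fun w => ?_)
  simp only [Real.rpow_natCast]
  congr 2
  ring

open MeasureTheory in
theorem integral_pow_mul_gaussian {x : ℝ} (hx : 0 < x) (k : ℕ) :
    ∫ w : ℝ, w ^ (2 * k) * Real.exp (-(x * w ^ 2 / 2)) =
      Real.sqrt (2 * Real.pi / x) * (poch (1 / 2) k / (x / 2) ^ k) := by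
  have h1 := integral_rpow_mul_exp_neg_mul_rpow (p := 2) (q := (2 * k : ℕ)) (b := x / 2) two_pos
    (by have : (0 : ℝ) ≤ (2 * k : ℕ) := by positivity
        linarith) (half_pos hx)
  have h2 := integral_comp_abs (f := fun w : ℝ => w ^ (2 * k) * Real.exp (-(x * w ^ 2 / 2)))
  simp only [pow_mul, sq_abs] at h2 ⊢
  rw [h2]
  have h3 : ∫ w in Set.Ioi (0 : ℝ), (w ^ 2) ^ k * Real.exp (-(x * w ^ 2 / 2)) =
      ∫ w in Set.Ioi (0 : ℝ), w ^ ((2 * k : ℕ) : ℝ) * Real.exp (-(x / 2) * w ^ (2 : ℝ)) := by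
    congr 1
    ext w
    rw [Real.rpow_natCast, Real.rpow_two, pow_mul]
    congr 2
    ring
  have e1 : (((2 * k : ℕ) : ℝ) + 1) / 2 = k + 1 / 2 := by push_cast; ring
  have e2 : (x / 2) ^ (-(((2 * k : ℕ) : ℝ) + 1) / 2) =
      (Real.sqrt (x / 2))⁻¹ * ((x / 2) ^ k)⁻¹ := by
    rw [neg_div, e1, Real.rpow_neg (half_pos hx).le, Real.rpow_add (half_pos hx), Real.rpow_natCast,
      ← Real.sqrt_eq_rpow, mul_inv, mul_comm]
  rw [h3, h1, e1, e2, Gamma_nat_add_half]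
  have e3 : Real.sqrt (2 * Real.pi / x) = Real.sqrt Real.pi * (Real.sqrt (x / 2))⁻¹ := by
    rw [← Real.sqrt_inv, ← Real.sqrt_mul Real.pi_pos.le]
    congr 1
    field_simp
  rw [e3]
  ring

theorem gaussian_moment_isBigO {N k : ℕ} (hk : N ≤ k) :
    (fun x : ℝ => Real.sqrt (2 * Real.pi / x) * (poch (1 / 2) k / (x / 2) ^ k)) =O[atTop]
      fun x => Real.sqrt (2 * Real.pi / x) / x ^ N := by
  simp only [div_eq_mul_inv (Real.sqrt _) (_ ^ N)]
  refine (isBigO_refl _ _).mul (IsBigO.of_bound (poch (1 / 2) k * 2 ^ k) ?_)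
  filter_upwards [eventually_ge_atTop 1] with x hx
  have hx0 : 0 < x := by linarith
  have := poch_half_pos k
  rw [Real.norm_of_nonneg (by positivity), Real.norm_of_nonneg (by positivity), div_pow,
    div_div_eq_mul_div, div_eq_mul_inv]
  gcongr

open MeasureTheory in
/-- Laplace's method for an integrand with an even Gaussian phase. -/
theorem gaussian_expansion {E : ℝ → ℂ} {e : ℕ → ℂ} {η C : ℝ} {N : ℕ} (hη : 0 < η)
    (hC0 : 0 ≤ C) (hE : ContinuousOn E (Set.Icc (-η) η))
    (hbound : ∀ w ∈ Set.Icc (-η) η, ‖E w - ∑ k ∈ Finset.range N, e k * (w : ℂ) ^ (2 * k)‖ ≤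
      C * w ^ (2 * N)) :
    (fun x : ℝ => (∫ w in (-η)..η, Complex.exp (-(x * w ^ 2 / 2)) * E w) -
      ∑ k ∈ Finset.range N, e k * ((Real.sqrt (2 * Real.pi / x) *
        (poch (1 / 2) k / (x / 2) ^ k) : ℝ) : ℂ)) =O[atTop]
      fun x => Real.sqrt (2 * Real.pi / x) / x ^ N := by
  set M : ℝ → ℕ → ℝ := fun x k => Real.sqrt (2 * Real.pi / x) * (poch (1 / 2) k / (x / 2) ^ k)
    with hM
  -- One majorant on the whole line covers both errors: the remainder inside `[-η, η]`, and the
  -- polynomial outside, where `1 ≤ (w/η)^(2N)` trades each `w^(2k)` for a higher moment.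
  have hmaj : (fun x : ℝ => C * M x N + ∑ k ∈ Finset.range N, ‖e k‖ * (η ^ (2 * N))⁻¹ *
      M x (k + N)) =O[atTop] fun x => Real.sqrt (2 * Real.pi / x) / x ^ N := by
    refine ((gaussian_moment_isBigO le_rfl).const_mul_left C).add (IsBigO.fun_sum fun k _ => ?_)
    exact (gaussian_moment_isBigO (Nat.le_add_left N k)).const_mul_left _
  refine IsBigO.trans (IsBigO.of_bound 1 ?_) hmaj
  filter_upwards [eventually_gt_atTop 0] with x hx
  have hg : ∀ w : ℝ, Complex.exp (-(x * w ^ 2 / 2)) = (Real.exp (-(x * w ^ 2 / 2)) : ℂ) := fun w => by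
    push_cast; rfl
  set F : ℝ → ℂ := (Set.Icc (-η) η).indicator fun w => Complex.exp (-(x * w ^ 2 / 2)) * E w
  have hFi : Integrable F := by
    rw [integrable_indicator_iff measurableSet_Icc]
    refine ContinuousOn.integrableOn_compact isCompact_Icc (ContinuousOn.mul ?_ hE)
    fun_prop
  have hGi : ∀ k, Integrable fun w : ℝ => e k * (((w ^ (2 * k) * Real.exp (-(x * w ^ 2 / 2)) : ℝ)) : ℂ) :=
    fun k => (integrable_pow_mul_gaussian hx k).ofReal.const_mul (e k)
  have hlhs : (∫ w in (-η)..η, Complex.exp (-(x * w ^ 2 / 2)) * E w) -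
      ∑ k ∈ Finset.range N, e k * (M x k : ℂ) =
      ∫ w, F w - ∑ k ∈ Finset.range N, e k * (((w ^ (2 * k) * Real.exp (-(x * w ^ 2 / 2)) : ℝ)) : ℂ) := by
    rw [integral_sub hFi (integrable_finsetSum _ fun k _ => hGi k),
      integral_indicator measurableSet_Icc, intervalIntegral.integral_of_le (by linarith),
      integral_Icc_eq_integral_Ioc, integral_finsetSum _ fun k _ => hGi k]
    congr 1
    refine Finset.sum_congr rfl fun k _ => ?_
    rw [integral_const_mul, integral_complex_ofReal, integral_pow_mul_gaussian hx]
  have hB0 : ∀ k, Integrable fun w : ℝ => ‖e k‖ * (η ^ (2 * N))⁻¹ *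
      (w ^ (2 * (k + N)) * Real.exp (-(x * w ^ 2 / 2))) := fun k =>
    (integrable_pow_mul_gaussian hx (k + N)).const_mul _
  have hrhs : C * M x N + ∑ k ∈ Finset.range N, ‖e k‖ * (η ^ (2 * N))⁻¹ * M x (k + N) =
      ∫ w, C * (w ^ (2 * N) * Real.exp (-(x * w ^ 2 / 2))) +
        ∑ k ∈ Finset.range N, ‖e k‖ * (η ^ (2 * N))⁻¹ *
          (w ^ (2 * (k + N)) * Real.exp (-(x * w ^ 2 / 2))) := by
    rw [integral_add ((integrable_pow_mul_gaussian hx N).const_mul C)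
      (integrable_finsetSum _ fun k _ => hB0 k), integral_finsetSum _ fun k _ => hB0 k,
      integral_const_mul, integral_pow_mul_gaussian hx]
    congr 1
    refine Finset.sum_congr rfl fun k _ => ?_
    rw [integral_const_mul, integral_pow_mul_gaussian hx]
  rw [one_mul]
  refine le_trans ?_ (Real.le_norm_self _)
  change ‖(∫ w in (-η)..η, Complex.exp (-(x * w ^ 2 / 2)) * E w) -
      ∑ k ∈ Finset.range N, e k * (M x k : ℂ)‖ ≤ _
  rw [hlhs, hrhs]
  refine norm_integral_le_of_norm_le (((integrable_pow_mul_gaussian hx N).const_mul C).add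
    (integrable_finsetSum _ fun k _ => hB0 k)) (Eventually.of_forall fun w => ?_)
  have hpos : ∀ j : ℕ, 0 ≤ w ^ (2 * j) := fun j => (even_two_mul j).pow_nonneg w
  have hs0 : 0 ≤ ∑ k ∈ Finset.range N, ‖e k‖ * (η ^ (2 * N))⁻¹ *
      (w ^ (2 * (k + N)) * Real.exp (-(x * w ^ 2 / 2))) :=
    Finset.sum_nonneg fun k _ => mul_nonneg (by positivity)
      (mul_nonneg (hpos _) (Real.exp_pos _).le)
  by_cases hw : w ∈ Set.Icc (-η) η
  · have e1 : F w - ∑ k ∈ Finset.range N, e k *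
        (((w ^ (2 * k) * Real.exp (-(x * w ^ 2 / 2)) : ℝ)) : ℂ) =
        (Real.exp (-(x * w ^ 2 / 2)) : ℂ) *
          (E w - ∑ k ∈ Finset.range N, e k * (w : ℂ) ^ (2 * k)) := by
      simp only [F, Set.indicator_of_mem hw]
      rw [hg, mul_sub, Finset.mul_sum]
      congr 1
      refine Finset.sum_congr rfl fun k _ => ?_
      push_cast
      ring
    rw [e1, norm_mul, Complex.norm_real, Real.norm_of_nonneg (Real.exp_pos _).le]
    have := mul_le_mul_of_nonneg_left (hbound w hw) (Real.exp_pos (-(x * w ^ 2 / 2))).le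
    linarith
  · have hw2 : η ^ 2 ≤ w ^ 2 := by
      rw [sq_le_sq, abs_of_pos hη]
      by_contra! h
      exact hw ⟨(abs_lt.1 h).1.le, (abs_lt.1 h).2.le⟩
    have hw3 : 1 ≤ (η ^ (2 * N))⁻¹ * w ^ (2 * N) := by
      rw [inv_mul_eq_div, le_div_iff₀ (by positivity), one_mul, pow_mul, pow_mul]
      gcongr
    simp only [F, Set.indicator_of_notMem hw, zero_sub, norm_neg]
    have h0 : 0 ≤ C * (w ^ (2 * N) * Real.exp (-(x * w ^ 2 / 2))) :=
      mul_nonneg hC0 (mul_nonneg (hpos _) (Real.exp_pos _).le)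
    refine (norm_sum_le _ _).trans (le_trans (Finset.sum_le_sum fun k _ => ?_)
      (le_add_of_nonneg_left h0))
    rw [norm_mul, Complex.norm_real, Real.norm_of_nonneg (mul_nonneg (hpos k) (Real.exp_pos _).le),
      mul_assoc]
    refine mul_le_mul_of_nonneg_left ?_ (norm_nonneg _)
    have h4 := mul_le_mul_of_nonneg_left hw3 (mul_nonneg (hpos k) (Real.exp_pos (-(x * w ^ 2 / 2))).le)
    rw [mul_one] at h4
    refine h4.trans (le_of_eq ?_)
    rw [mul_add 2 k N, pow_add]
    ring

/-- The constant depends on `ρ` and `N` but not on `w`; it supplies the uniform remainder for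
`gaussian_expansion`. -/
theorem norm_sub_partial_sum_le {e : ℕ → ℂ} {ρ : ℝ} (hρ : 0 < ρ)
    (hsum : Summable fun k => e k * (ρ : ℂ) ^ (2 * k)) {w : ℂ} {E : ℂ} (hw : ‖w‖ ≤ ρ)
    (hE : HasSum (fun k => e k * w ^ (2 * k)) E) (N : ℕ) :
    ‖E - ∑ k ∈ Finset.range N, e k * w ^ (2 * k)‖ ≤
      (∑' k, ‖e (k + N)‖ * ρ ^ (2 * k)) * ‖w‖ ^ (2 * N) := by
  have h1 := (hasSum_nat_add_iff' N).2 hE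
  have hs : Summable fun k => ‖e (k + N)‖ * ρ ^ (2 * k) := by
    have h2 := (((summable_nat_add_iff N).2 hsum.norm).mul_right (ρ ^ (2 * N))⁻¹)
    refine h2.congr fun k => ?_
    rw [norm_mul, norm_pow, Complex.norm_real, Real.norm_of_nonneg hρ.le, mul_add 2 k N, pow_add]
    field_simp
  rw [← h1.tsum_eq]
  refine tsum_of_norm_bounded (hs.hasSum.mul_right _) fun k => ?_
  rw [norm_mul, norm_pow, mul_add 2 k N, pow_add, mul_assoc]
  gcongr

theorem exp_neg_isBigO_gaussian {κ : ℝ} (hκ : 0 < κ) (N : ℕ) :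
    (fun x : ℝ => Real.exp (-κ * x)) =O[atTop] fun x => Real.sqrt (2 * Real.pi / x) / x ^ N := by
  refine (isLittleO_exp_neg_mul_rpow_atTop hκ (-(N + 1 / 2))).isBigO.trans
    (IsBigO.of_bound 1 ?_)
  filter_upwards [eventually_gt_atTop 0] with x hx
  rw [Real.norm_of_nonneg (by positivity), Real.norm_of_nonneg (by positivity), one_mul,
    Real.rpow_neg hx.le, Real.rpow_add hx, Real.rpow_natCast, ← Real.sqrt_eq_rpow, mul_inv,
    ← Real.sqrt_inv, div_eq_mul_inv, mul_comm]
  gcongr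
  rw [inv_eq_one_div]
  gcongr
  nlinarith [Real.pi_gt_three]

/-! ### Laplace's method along a complex path -/

/-- In the cone `|Im w| ≤ Re w / 2` with `Re w ≥ ρ` one has `Re w² ≥ 3ρ²/4`, whence the rate
`3ρ²/8`. The conditions are convex, so they hold on the segment from `q` to `p`. -/
theorem norm_primitive_sub_le {v P : ℂ → ℂ} {R B ρ x : ℝ} (hx : 0 ≤ x) (hρ : 0 < ρ)
    (hP : ∀ w ∈ Metric.ball (0 : ℂ) R, HasDerivAt P (Complex.exp (-(x * w ^ 2 / 2)) * v w) w)
    (hB : ∀ w ∈ Metric.ball (0 : ℂ) R, ‖v w‖ ≤ B) {p q : ℂ} (hp : p ∈ Metric.ball (0 : ℂ) R)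
    (hq : q ∈ Metric.ball (0 : ℂ) R) (hpre : ρ ≤ p.re) (hqre : ρ ≤ q.re)
    (hpim : |p.im| ≤ p.re / 2) (hqim : |q.im| ≤ q.re / 2) :
    ‖P p - P q‖ ≤ B * (2 * R) * Real.exp (-(3 * ρ ^ 2 / 8) * x) := by
  have hseg : ∀ w ∈ segment ℝ q p, w ∈ Metric.ball (0 : ℂ) R ∧ ρ ≤ w.re ∧ |w.im| ≤ w.re / 2 := by
    intro w hw
    refine ⟨(convex_ball _ _).segment_subset hq hp hw, ?_⟩
    obtain ⟨s, t, hs, ht, hst, rfl⟩ := hw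
    simp only [Complex.add_re, Complex.add_im, Complex.real_smul, Complex.re_ofReal_mul,
      Complex.im_ofReal_mul]
    rw [abs_le] at hpim hqim ⊢
    refine ⟨?_, ?_, ?_⟩
    · have : s * ρ + t * ρ = ρ := by rw [← add_mul, hst, one_mul]
      nlinarith [mul_le_mul_of_nonneg_left hqre hs, mul_le_mul_of_nonneg_left hpre ht]
    · nlinarith [mul_le_mul_of_nonneg_left hqim.1 hs, mul_le_mul_of_nonneg_left hpim.1 ht]
    · nlinarith [mul_le_mul_of_nonneg_left hqim.2 hs, mul_le_mul_of_nonneg_left hpim.2 ht]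
  have hB0 : 0 ≤ B := (norm_nonneg _).trans (hB p hp)
  have hmv := (convex_segment q p).norm_image_sub_le_of_norm_hasDerivWithin_le
    (C := B * Real.exp (-(3 * ρ ^ 2 / 8) * x))
    (fun w hw => (hP w (hseg w hw).1).hasDerivWithinAt) (fun w hw => ?_)
    (left_mem_segment ℝ q p) (right_mem_segment ℝ q p)
  · refine hmv.trans ?_
    have h1 : ‖p - q‖ ≤ 2 * R := by
      have := norm_sub_le p q
      rw [mem_ball_zero_iff] at hp hq
      linarith
    calc _ ≤ B * Real.exp (-(3 * ρ ^ 2 / 8) * x) * (2 * R) := by gcongr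
      _ = _ := by ring
  · obtain ⟨h1, h2, h3⟩ := hseg w hw
    rw [norm_mul, Complex.norm_exp, mul_comm]
    refine mul_le_mul (hB w h1) (Real.exp_le_exp.2 ?_) (Real.exp_pos _).le hB0
    have e : (-(x * w ^ 2 / 2 : ℂ)).re = -(x * (w.re ^ 2 - w.im ^ 2) / 2) := by
      rw [show (x * w ^ 2 / 2 : ℂ) = ((x / 2 : ℝ) : ℂ) * w ^ 2 by push_cast; ring, Complex.neg_re,
        Complex.re_ofReal_mul, sq, Complex.mul_re]
      ring
    rw [e]
    have h4 : w.im ^ 2 ≤ (w.re / 2) ^ 2 := by rw [← sq_abs w.im]; gcongr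
    have h5 : ρ ^ 2 ≤ w.re ^ 2 := by gcongr
    have h6 : 3 * ρ ^ 2 / 4 ≤ w.re ^ 2 - w.im ^ 2 := by nlinarith
    nlinarith [mul_le_mul_of_nonneg_left h6 hx]

open MeasureTheory in
/-- Asymptotic expansion of the integral of `exp (-x w ^ 2 / 2) * v w` along a path from `q` to `p`
through the saddle point `0`. The integral is described by primitives. -/
theorem path_expansion {v : ℂ → ℂ} {R B ρ : ℝ} {e : ℕ → ℂ} {p q : ℂ} {J : ℝ → ℂ} (hR : 0 < R)
    (hρ : 0 < ρ) (hv : DifferentiableOn ℂ v (Metric.ball 0 R))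
    (hB : ∀ w ∈ Metric.ball (0 : ℂ) R, ‖v w‖ ≤ B)
    (he : ∀ w ∈ Metric.ball (0 : ℂ) R,
      HasSum (fun k => e k * w ^ (2 * k)) ((v w + v (-w)) / 2))
    (hp : p ∈ Metric.ball (0 : ℂ) R) (hq : q ∈ Metric.ball (0 : ℂ) R)
    (hpre : ρ ≤ p.re) (hqre : q.re ≤ -ρ) (hpim : |p.im| ≤ p.re / 2) (hqim : |q.im| ≤ -q.re / 2)
    -- Stating the integral through primitives makes it path independent in the disc, so no curve
    -- has to be deformed.
    (hJ : ∀ x : ℝ, 0 < x → ∀ P : ℂ → ℂ,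
      (∀ w ∈ Metric.ball (0 : ℂ) R, HasDerivAt P (Complex.exp (-(x * w ^ 2 / 2)) * v w) w) →
      J x = P p - P q) (N : ℕ) :
    (fun x : ℝ => J x - ∑ k ∈ Finset.range N, e k * ((Real.sqrt (2 * Real.pi / x) *
        (poch (1 / 2) k / (x / 2) ^ k) : ℝ) : ℂ)) =O[atTop]
      fun x => Real.sqrt (2 * Real.pi / x) / x ^ N := by
  set η := min (R / 2) ρ with hη
  have hη0 : 0 < η := lt_min (half_pos hR) hρ
  have hηR : η < R := (min_le_left _ _).trans_lt (half_lt_self hR)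
  have hmem : ∀ w : ℝ, w ∈ Set.Icc (-η) η → (w : ℂ) ∈ Metric.ball (0 : ℂ) R := fun w hw => by
    rw [mem_ball_zero_iff, Complex.norm_real, Real.norm_eq_abs]
    exact (abs_le.2 hw).trans_lt hηR
  have hvc : ContinuousOn (fun w : ℝ => v w) (Set.Icc (-η) η) :=
    hv.continuousOn.comp Complex.continuous_ofReal.continuousOn hmem
  have hvc' : ContinuousOn (fun w : ℝ => v (-w)) (Set.Icc (-η) η) :=
    hv.continuousOn.comp (t := Metric.ball 0 R) (by fun_prop) fun w hw => by
      have := hmem (-w) ⟨neg_le_neg hw.2, by linarith [hw.1]⟩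
      simpa using this
  have hmain := gaussian_expansion (E := fun w : ℝ => (v w + v (-w)) / 2) (e := e) (N := N)
    (C := ∑' k, ‖e (k + N)‖ * η ^ (2 * k)) hη0
    (tsum_nonneg fun k => by positivity) ((hvc.add hvc').div_const 2) fun w hw => by
      have h1 := norm_sub_partial_sum_le hη0 (he η (hmem η ⟨by linarith, le_rfl⟩)).summable
        (w := w) (by rw [Complex.norm_real, Real.norm_eq_abs]; exact abs_le.2 hw) (he w (hmem w hw)) N
      rwa [Complex.norm_real, Real.norm_eq_abs, (even_two_mul N).pow_abs] at h1
  have hκ : 0 < 3 * η ^ 2 / 8 := by positivity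
  have hdiff : (fun x : ℝ => J x - ∫ w in (-η)..η, Complex.exp (-(x * w ^ 2 / 2)) *
      ((v w + v (-w)) / 2)) =O[atTop] fun x => Real.sqrt (2 * Real.pi / x) / x ^ N := by
    refine IsBigO.trans (IsBigO.of_bound (2 * (B * (2 * R))) ?_) (exp_neg_isBigO_gaussian hκ N)
    filter_upwards [eventually_gt_atTop 0] with x hx
    have hFd : DifferentiableOn ℂ (fun w => Complex.exp (-(x * w ^ 2 / 2)) * v w)
        (Metric.ball 0 R) := DifferentiableOn.mul (by fun_prop) hv
    obtain ⟨P, hP⟩ := hFd.isExactOn_ball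
    have hec : Continuous fun w : ℝ => Complex.exp (-(x * w ^ 2 / 2)) := by fun_prop
    have hi1 : IntervalIntegrable (fun w : ℝ => Complex.exp (-(x * w ^ 2 / 2)) * v w) volume
        (-η) η := by
      refine ContinuousOn.intervalIntegrable ?_
      rw [Set.uIcc_of_le (by linarith)]
      exact hec.continuousOn.mul hvc
    have hi2 : IntervalIntegrable (fun w : ℝ => Complex.exp (-(x * w ^ 2 / 2)) * v (-w)) volume
        (-η) η := by
      refine ContinuousOn.intervalIntegrable ?_
      rw [Set.uIcc_of_le (by linarith)]
      exact hec.continuousOn.mul hvc'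
    -- On the symmetric interval `v` may be replaced by its even part.
    have hsymm : ∫ w in (-η)..η, Complex.exp (-(x * w ^ 2 / 2)) * v (-w) =
        ∫ w in (-η)..η, Complex.exp (-(x * w ^ 2 / 2)) * v w := by
      have h := intervalIntegral.integral_comp_neg (a := -η) (b := η)
        fun w : ℝ => Complex.exp (-(x * w ^ 2 / 2)) * v w
      rw [neg_neg] at h
      rw [← h]
      simp
    have hint : ∫ w in (-η)..η, Complex.exp (-(x * w ^ 2 / 2)) * ((v w + v (-w)) / 2) =
        P η - P (-η) := by
      have h1 : ∫ w in (-η)..η, Complex.exp (-(x * w ^ 2 / 2)) * v w = P η - P (-η) := by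
        rw [intervalIntegral.integral_eq_sub_of_hasDerivAt (f := fun w : ℝ => P w)
          (fun w hw => ?_) hi1]
        · simp
        · rw [Set.uIcc_of_le (by linarith)] at hw
          exact (hP w (hmem w hw)).comp_ofReal
      rw [← h1]
      have h2 : ∀ w : ℝ, Complex.exp (-(x * w ^ 2 / 2)) * ((v w + v (-w)) / 2) =
          (Complex.exp (-(x * w ^ 2 / 2)) * v w + Complex.exp (-(x * w ^ 2 / 2)) * v (-w)) / 2 :=
        fun w => by ring
      simp only [h2]
      rw [intervalIntegral.integral_div, intervalIntegral.integral_add hi1 hi2, hsymm]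
      ring
    rw [hJ x hx P hP, hint, Real.norm_of_nonneg (Real.exp_pos _).le]
    have hηre : (η : ℂ).im = 0 := Complex.ofReal_im η
    have hb1 := norm_primitive_sub_le hx.le hη0 hP hB hp (hmem η ⟨by linarith, le_rfl⟩)
      ((min_le_right _ _).trans hpre) le_rfl hpim (by rw [hηre, abs_zero]; exact (half_pos hη0).le)
    -- The left end is reflected into the right cone.
    have hP' : ∀ w ∈ Metric.ball (0 : ℂ) R, HasDerivAt (fun w => P (-w))
        (Complex.exp (-(x * w ^ 2 / 2)) * (-v (-w))) w := fun w hw => by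
      have h := (hP (-w) (by simpa using hw)).comp w (hasDerivAt_neg w)
      refine h.congr_deriv ?_
      simp only [neg_sq]
      ring
    have hb2 := norm_primitive_sub_le (v := fun w => -v (-w)) (B := B) hx.le hη0 hP'
      (fun w hw => by rw [norm_neg]; exact hB _ (by simpa using hw)) (p := -q) (q := η)
      (by simpa using hq) (hmem η ⟨by linarith, le_rfl⟩)
      (by rw [Complex.neg_re]; linarith [min_le_right (R / 2) ρ]) le_rfl
      (by rwa [Complex.neg_im, Complex.neg_re, abs_neg])
      (by rw [hηre, abs_zero]; exact (half_pos hη0).le)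
    rw [neg_neg] at hb2
    calc ‖P p - P q - (P η - P (-η))‖ = ‖(P p - P η) - (P q - P (-η))‖ := by congr 1; ring
      _ ≤ ‖P p - P η‖ + ‖P q - P (-η)‖ := norm_sub_le _ _
      _ ≤ _ := by linarith
  exact (hdiff.add hmain).congr_left fun x => by ring

/-! ### Contribution of the saddle point -/

theorem one_add_mul_I_mem_slitPlane (τ : ℝ) : (1 + τ * Complex.I : ℂ) ∈ Complex.slitPlane :=
  Or.inl (by simp)

theorem hasDerivAt_log_one_add_mul_I (τ : ℝ) :
    HasDerivAt (fun τ : ℝ => Complex.log (1 + τ * Complex.I)) (Complex.I / (1 + τ * Complex.I)) τ := by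
  have h := (((hasDerivAt_id (τ : ℂ)).mul_const Complex.I).const_add 1).comp_ofReal
  exact (h.clog_real (one_add_mul_I_mem_slitPlane τ)).congr_deriv (by simp)

/-- The integrand of the Bromwich integral of the Wright function, on the vertical line through
`exp u0`, divided by its exponential size at the saddle point. -/
def saddleIntegrand (lam a u0 x τ : ℝ) : ℂ :=
  Complex.exp (x * (phaseC lam a (u0 + Complex.log (1 + τ * Complex.I)) - phaseC lam a u0)) /
    (1 + τ * Complex.I)

theorem continuous_saddleIntegrand (lam a u0 x : ℝ) : Continuous (saddleIntegrand lam a u0 x) := by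
  have h : Continuous fun τ : ℝ => Complex.log (1 + τ * Complex.I) :=
    continuous_iff_continuousAt.2 fun τ => (hasDerivAt_log_one_add_mul_I τ).continuousAt
  unfold saddleIntegrand phaseC
  refine Continuous.div (by fun_prop) (by fun_prop) fun τ =>
    Complex.slitPlane_ne_zero (one_add_mul_I_mem_slitPlane τ)

/-- A curve with positive real velocity at `0` stays near the real axis; the margin `m/4` places the
end points in the cones of `path_expansion`. -/
theorem cone_of_hasDerivAt {f : ℝ → ℂ} {m : ℝ} (hm : 0 < m) (hf : HasDerivAt f m 0) (h0 : f 0 = 0) :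
    ∀ᶠ τ : ℝ in 𝓝 0, |(f τ).re - m * τ| ≤ m / 4 * |τ| ∧ |(f τ).im| ≤ m / 4 * |τ| := by
  have h := (hasDerivAt_iff_isLittleO.1 hf).def (show 0 < m / 4 by positivity)
  filter_upwards [h] with τ hτ
  rw [h0, sub_zero, sub_zero, Real.norm_eq_abs] at hτ
  have h1 := (Complex.abs_re_le_norm _).trans hτ
  have h2 := (Complex.abs_im_le_norm _).trans hτ
  simp only [Complex.sub_re, Complex.sub_im, Complex.real_smul, Complex.re_ofReal_mul,
    Complex.im_ofReal_mul, Complex.ofReal_re, Complex.ofReal_im, mul_zero, sub_zero] at h1 h2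
  rw [mul_comm τ m] at h1
  exact ⟨h1, h2⟩

namespace IsSaddleReversion

variable {lam a u0 : ℝ} {Ψ S : ℂ → ℂ}

theorem local_expansion (hS : IsSaddleReversion lam a u0 Ψ S) (h2 : 0 < phaseDeriv lam a u0 2) :
    ∃ δ : ℝ, 0 < δ ∧ ∀ N : ℕ, (fun x : ℝ => (∫ τ in (-δ)..δ, saddleIntegrand lam a u0 x τ) -
      ((∑ k ∈ Finset.range N, (-1) ^ k * reversionCoeff lam a u0 S k *
        (Real.sqrt (2 * Real.pi / x) * (poch (1 / 2) k / (x / 2) ^ k)) /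
          Real.sqrt (phaseDeriv lam a u0 2) : ℝ) : ℂ)) =O[atTop]
      fun x => Real.sqrt (2 * Real.pi / x) / x ^ N := by
  have hm : 0 < Real.sqrt (phaseDeriv lam a u0 2) := Real.sqrt_pos.2 h2
  have h2' : (phaseDeriv lam a u0 2 : ℂ) ≠ 0 := by exact_mod_cast h2.ne'
  have hm' : (Real.sqrt (phaseDeriv lam a u0 2) : ℂ) ≠ 0 := by exact_mod_cast hm.ne'
  set c := invSqrtNeg lam a u0 with hc
  have hc0 : c ≠ 0 := by
    rw [hc, invSqrtNeg]; exact div_ne_zero Complex.I_ne_zero hm'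
  set u : ℂ → ℂ := fun w => u0 + S (c * w) with hu
  have hua : AnalyticAt ℂ u 0 := (hS.isLocalReversion h2).analyticAt
  obtain ⟨R, hR, hball⟩ := Metric.eventually_nhds_iff_ball.1
    ((hS.hasSum_deriv h2).and (hua.eventually_analyticAt.and
      (hua.deriv.continuousAt.norm.eventually_le_const (lt_add_one ‖deriv u 0‖))))
  set l : ℝ → ℂ := fun τ => Complex.log (1 + τ * Complex.I) with hl
  have hl0 : l 0 = 0 := by simp [hl]
  have hld : ∀ τ : ℝ, HasDerivAt l (Complex.I / (1 + τ * Complex.I)) τ := hasDerivAt_log_one_add_mul_I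
  have hlt : Tendsto l (𝓝 0) (𝓝 0) := by simpa [hl0] using (hld 0).continuousAt.tendsto
  set g : ℝ → ℂ := fun τ => Ψ (l τ) / c with hg
  have hg0 : g 0 = 0 := by simp [hg, hl0, hS.sqrt_zero]
  -- `g` is the path in the variable `w`. The branch `c = i/√h₀''` makes its velocity `i/c = √h₀''`,
  -- real and positive.
  have hgd : HasDerivAt g (Real.sqrt (phaseDeriv lam a u0 2) : ℝ) 0 := by
    have h1 := hS.analyticAt_sqrt.differentiableAt.hasDerivAt.comp_of_eq (0 : ℝ) (hld 0) hl0.symm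
    refine (h1.div_const c).congr_deriv ?_
    rw [hS.deriv_sqrt, hc, invSqrtNeg]
    field_simp
    simp
  have hgt : Tendsto g (𝓝 0) (𝓝 0) := by simpa [hg0] using hgd.continuousAt.tendsto
  obtain ⟨ε, hε, hτ⟩ := Metric.eventually_nhds_iff_ball.1
    ((hlt.eventually hS.left_inv.eventually_nhds).and ((hlt.eventually hS.sqrt_sq).and
      ((hlt.eventually hS.analyticAt_sqrt.eventually_analyticAt).and
        ((hgt.eventually (Metric.ball_mem_nhds 0 hR)).and (cone_of_hasDerivAt hm hgd hg0)))))
  set δ := ε / 2 with hδ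
  have hδ0 : 0 < δ := half_pos hε
  have hmem : ∀ τ ∈ Set.Icc (-δ) δ, τ ∈ Metric.ball (0 : ℝ) ε := fun τ h => by
    rw [mem_ball_zero_iff, Real.norm_eq_abs]
    exact (abs_le.2 h).trans_lt (half_lt_self hε)
  have hJ : ∀ x : ℝ, 0 < x → ∀ P : ℂ → ℂ,
      (∀ w ∈ Metric.ball (0 : ℂ) R, HasDerivAt P (Complex.exp (-(x * w ^ 2 / 2)) * deriv u w) w) →
      ∫ τ in (-δ)..δ, saddleIntegrand lam a u0 x τ * Complex.I = P (g δ) - P (g (-δ)) := by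
    intro x hx P hP
    refine intervalIntegral.integral_eq_sub_of_hasDerivAt (f := fun τ => P (g τ)) (fun τ h => ?_)
      (((continuous_saddleIntegrand lam a u0 x).mul continuous_const).intervalIntegrable _ _)
    rw [Set.uIcc_of_le (by linarith)] at h
    obtain ⟨t1, t2, t3, t4, -⟩ := hτ τ (hmem τ h)
    have hg' : HasDerivAt g (deriv g τ) τ := by
      have h3 := t3.differentiableAt.hasDerivAt.comp τ (hld τ)
      exact (h3.div_const c).differentiableAt.hasDerivAt
    -- Differentiate `u (g τ) = u₀ + log (1 + iτ)`, valid near `τ` because `S` inverts `Ψ`.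
    have hug : deriv u (g τ) * deriv g τ = Complex.I / (1 + τ * Complex.I) := by
      have h3 := (hball (g τ) t4).2.1.differentiableAt.hasDerivAt.comp τ hg'
      refine h3.unique (((hld τ).const_add (u0 : ℂ)).congr_of_eventuallyEq ?_)
      filter_upwards [(hld τ).continuousAt.tendsto.eventually t1] with σ hσ
      simp only [Function.comp, hu, hg]
      rw [mul_div_cancel₀ _ hc0, hσ]
    refine ((hP (g τ) t4).comp τ hg').congr_deriv ?_
    rw [mul_assoc, hug, saddleIntegrand, ← t2]
    have e1 : (-(x * g τ ^ 2 / 2) : ℂ) = x * ((phaseDeriv lam a u0 2 : ℂ) / 2 * Ψ (l τ) ^ 2) := by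
      simp only [hg]
      rw [div_pow, hc, invSqrtNeg_sq h2]
      field_simp
    rw [e1]
    ring
  have hp := hτ δ (hmem δ ⟨by linarith, le_rfl⟩)
  have hq := hτ (-δ) (hmem (-δ) ⟨le_rfl, by linarith⟩)
  obtain ⟨-, -, -, p4, p5, p6⟩ := hp
  obtain ⟨-, -, -, q4, q5, q6⟩ := hq
  rw [abs_of_pos hδ0, abs_le] at p5
  rw [abs_of_pos hδ0] at p6
  rw [abs_neg, abs_of_pos hδ0, abs_le] at q5
  rw [abs_neg, abs_of_pos hδ0] at q6
  have hmδ : 0 < Real.sqrt (phaseDeriv lam a u0 2) * δ := mul_pos hm hδ0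
  refine ⟨δ, hδ0, fun N => ?_⟩
  have key := path_expansion (v := deriv u) (B := ‖deriv u 0‖ + 1)
    (ρ := Real.sqrt (phaseDeriv lam a u0 2) * δ / 2)
    (e := fun k => c * ((-1) ^ k * (reversionCoeff lam a u0 S k : ℂ)))
    (p := g δ) (q := g (-δ)) (J := fun x => ∫ τ in (-δ)..δ, saddleIntegrand lam a u0 x τ * Complex.I)
    hR (by positivity) (fun w hw => (hball w hw).2.1.deriv.differentiableAt.differentiableWithinAt)
    (fun w hw => (hball w hw).2.2) (fun w hw => by simpa only [mul_assoc] using (hball w hw).1)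
    p4 q4 (by linarith) (by linarith) (by linarith) (by linarith) hJ N
  have key2 := key.const_mul_left Complex.I⁻¹
  refine key2.congr_left fun x => ?_
  rw [mul_sub, intervalIntegral.integral_mul_const, Finset.mul_sum]
  congr 1
  · field_simp
  · rw [Complex.ofReal_sum]
    refine Finset.sum_congr rfl fun k _ => ?_
    rw [hc, invSqrtNeg]
    push_cast
    field_simp

end IsSaddleReversion

/-! ### Decay of the phase along the vertical line -/

/-- While `kθ ≤ π`, cosine is decreasing, so the difference has derivative `k (cos t - cos (kt)) ≥
0`. Beyond that, Jordan's inequality already makes `k sin θ ≥ 1`. -/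
theorem sin_mul_le_mul_sin {k θ : ℝ} (hk : 1 ≤ k) (h0 : 0 ≤ θ) (h1 : θ ≤ Real.pi / 2) :
    Real.sin (k * θ) ≤ k * Real.sin θ := by
  rcases le_or_gt (k * θ) Real.pi with h | h
  · have hmono : MonotoneOn (fun t => k * Real.sin t - Real.sin (k * t)) (Set.Icc 0 θ) := by
      refine monotoneOn_of_deriv_nonneg (convex_Icc 0 θ) (by fun_prop) (by fun_prop) fun t ht => ?_
      rw [interior_Icc] at ht
      have hd : HasDerivAt (fun t => k * Real.sin t - Real.sin (k * t))
          (k * Real.cos t - Real.cos (k * t) * k) t :=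
        ((Real.hasDerivAt_sin t).const_mul k).sub
          (((hasDerivAt_id t).const_mul k).sin.congr_deriv (by simp only [id, mul_one]))
      rw [hd.deriv]
      have hle : Real.cos (k * t) ≤ Real.cos t := by
        refine Real.cos_le_cos_of_nonneg_of_le_pi ht.1.le ?_ (by nlinarith [ht.1])
        have := ht.2
        nlinarith
      nlinarith
    have := hmono ⟨le_rfl, h0⟩ ⟨h0, le_rfl⟩ h0
    simp only [mul_zero, Real.sin_zero, sub_zero] at this
    linarith
  · have h2 := Real.mul_le_sin h0 h1
    have h3 : 1 ≤ k * (2 / Real.pi * θ) := by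
      rw [show k * (2 / Real.pi * θ) = 2 * (k * θ) / Real.pi by ring, le_div_iff₀ Real.pi_pos]
      linarith [Real.pi_pos]
    exact (Real.sin_le_one _).trans (h3.trans (by gcongr))

theorem log_one_add_tan_mul_I {θ : ℝ} (h1 : -(Real.pi / 2) < θ) (h2 : θ < Real.pi / 2) :
    Complex.log (1 + (Real.tan θ : ℂ) * Complex.I) =
      ((-Real.log (Real.cos θ) : ℝ) : ℂ) + θ * Complex.I := by
  have hc : 0 < Real.cos θ := Real.cos_pos_of_mem_Ioo ⟨h1, h2⟩
  have hpi := Real.pi_pos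
  rw [← Complex.log_exp (x := ((-Real.log (Real.cos θ) : ℝ) : ℂ) + θ * Complex.I)
    (by simp; linarith) (by simp; linarith)]
  congr 1
  rw [Complex.exp_add, ← Complex.ofReal_exp, Real.exp_neg, Real.exp_log hc, Complex.exp_mul_I,
    ← Complex.ofReal_cos, ← Complex.ofReal_sin, Real.tan_eq_sin_div_cos]
  have : Complex.cos θ ≠ 0 := by rw [← Complex.ofReal_cos]; exact_mod_cast hc.ne'
  push_cast
  field_simp

/-- The real part of the phase on the vertical line through `exp u0`, relative to its value at the
saddle point, as a function of the angle. -/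
def phaseDecay (lam a u0 θ : ℝ) : ℝ :=
  Real.exp (-lam * u0) / 2 * (1 - Real.exp (lam * Real.log (Real.cos θ)) * Real.cos (lam * θ)) +
    a * Real.log (Real.cos θ)

/-- With `τ = tan θ`, `1 + iτ = e^(iθ) / cos θ`. The term `Re e^u` equals `e^(u₀)` all along the
line and drops out. -/
theorem re_phase_sub {θ : ℝ} (lam a u0 : ℝ) (h1 : -(Real.pi / 2) < θ) (h2 : θ < Real.pi / 2) :
    (phaseC lam a (u0 + Complex.log (1 + (Real.tan θ : ℂ) * Complex.I)) - phaseC lam a u0).re =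
      phaseDecay lam a u0 θ := by
  have hc : 0 < Real.cos θ := Real.cos_pos_of_mem_Ioo ⟨h1, h2⟩
  rw [log_one_add_tan_mul_I h1 h2]
  set L := Real.log (Real.cos θ) with hL
  set U : ℂ := u0 + (((-L : ℝ) : ℂ) + θ * Complex.I) with hU
  have hUre : U.re = u0 - L := by simp [hU, sub_eq_add_neg]
  have hUim : U.im = θ := by simp [hU]
  have r1 : ∀ V : ℂ, (phaseC lam a V).re = (Real.exp V.re * Real.cos V.im -
      Real.exp (-lam * V.re) * Real.cos (lam * V.im)) / 2 - a * V.re := by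
    intro V
    have e1 : (-(lam : ℂ) * V).re = -lam * V.re := by simp
    have e2 : (-(lam : ℂ) * V).im = -(lam * V.im) := by simp
    rw [phaseC, Complex.sub_re, Complex.re_ofReal_mul, ← Complex.ofReal_ofNat, Complex.div_ofReal_re,
      Complex.sub_re, Complex.exp_re, Complex.exp_re, e1, e2, Real.cos_neg]
  have e3 : Real.exp (u0 - L) * Real.cos θ = Real.exp u0 := by
    rw [Real.exp_sub, hL, Real.exp_log hc]; field_simp
  have e4 : Real.exp (-lam * (u0 - L)) = Real.exp (-lam * u0) * Real.exp (lam * L) := by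
    rw [← Real.exp_add]; congr 1; ring
  rw [Complex.sub_re, r1, r1, hUre, hUim, e3, e4, phaseDecay]
  simp
  ring

theorem phaseDecay_neg (lam a u0 θ : ℝ) : phaseDecay lam a u0 (-θ) = phaseDecay lam a u0 θ := by
  simp [phaseDecay]

theorem phaseDecay_zero (lam a u0 : ℝ) : phaseDecay lam a u0 0 = 0 := by
  simp [phaseDecay]

/-- The derivative has the sign of `λ e^(-λu₀) cos^λ θ sin ((1+λ)θ) - 2a sin θ`. For `λ ≤ 0` the
first term is nonpositive. For `λ > 0` it is at most `(λ² + λ) e^(-λu₀) sin θ`, and `h''(u₀) > 0`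
with the saddle equation makes this less than `2a sin θ`. -/
theorem strictAntiOn_phaseDecay {lam a u0 : ℝ} (ha : 0 < a) (hlam : -1 < lam)
    (h : Real.exp u0 + lam * Real.exp (-lam * u0) = 2 * a)
    (hpos : 0 < lam → lam ^ 2 * Real.exp (-lam * u0) < Real.exp u0) :
    StrictAntiOn (phaseDecay lam a u0) (Set.Ico 0 (Real.pi / 2)) := by
  have hd : ∀ θ ∈ Set.Ico 0 (Real.pi / 2), HasDerivAt (phaseDecay lam a u0)
      ((lam * Real.exp (-lam * u0) * Real.exp (lam * Real.log (Real.cos θ)) *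
        Real.sin ((1 + lam) * θ) - 2 * a * Real.sin θ) / (2 * Real.cos θ)) θ := by
    intro θ hθ
    have hc : 0 < Real.cos θ :=
      Real.cos_pos_of_mem_Ioo ⟨by linarith [hθ.1, Real.pi_pos], hθ.2⟩
    have h1 := (Real.hasDerivAt_cos θ).log hc.ne'
    have h2 := (h1.const_mul lam).exp
    have h3 : HasDerivAt (fun θ => Real.cos (lam * θ)) (-Real.sin (lam * θ) * lam) θ :=
      (((hasDerivAt_id θ).const_mul lam).cos).congr_deriv (by simp only [id, mul_one])
    refine ((((h2.mul h3).const_sub 1).const_mul (Real.exp (-lam * u0) / 2)).add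
      (h1.const_mul a)).congr_deriv ?_
    rw [add_mul, one_mul, Real.sin_add]
    field_simp
    ring
  refine strictAntiOn_of_deriv_neg (convex_Ico _ _)
    (fun θ hθ => (hd θ hθ).continuousAt.continuousWithinAt) fun θ hθ => ?_
  rw [interior_Ico] at hθ
  have hc : 0 < Real.cos θ :=
    Real.cos_pos_of_mem_Ioo ⟨by linarith [hθ.1, Real.pi_pos], hθ.2⟩
  have hs : 0 < Real.sin θ := Real.sin_pos_of_pos_of_lt_pi hθ.1 (by linarith [hθ.2, Real.pi_pos])
  rw [(hd θ ⟨hθ.1.le, hθ.2⟩).deriv]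
  refine div_neg_of_neg_of_pos (sub_neg.2 ?_) (by positivity)
  have hE := Real.exp_pos (-lam * u0)
  have hL := Real.exp_pos (lam * Real.log (Real.cos θ))
  rcases le_or_gt lam 0 with h0 | h0
  · have hs2 : 0 ≤ Real.sin ((1 + lam) * θ) :=
      Real.sin_nonneg_of_nonneg_of_le_pi (mul_nonneg (by linarith) hθ.1.le)
        (by nlinarith [hθ.1, hθ.2, Real.pi_pos])
    have : lam * Real.exp (-lam * u0) * Real.exp (lam * Real.log (Real.cos θ)) *
        Real.sin ((1 + lam) * θ) ≤ 0 := by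
      refine mul_nonpos_of_nonpos_of_nonneg ?_ hs2
      exact mul_nonpos_of_nonpos_of_nonneg (mul_nonpos_of_nonpos_of_nonneg h0 hE.le) hL.le
    refine this.trans_lt (by positivity)
  · have hsin : Real.sin ((1 + lam) * θ) ≤ (1 + lam) * Real.sin θ :=
      sin_mul_le_mul_sin (by linarith) hθ.1.le hθ.2.le
    have hL1 : Real.exp (lam * Real.log (Real.cos θ)) ≤ 1 :=
      Real.exp_le_one_iff.2 (mul_nonpos_of_nonneg_of_nonpos h0.le
        (Real.log_nonpos hc.le (Real.cos_le_one θ)))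
    calc _ ≤ lam * Real.exp (-lam * u0) * Real.exp (lam * Real.log (Real.cos θ)) *
          ((1 + lam) * Real.sin θ) := by gcongr
      _ ≤ lam * Real.exp (-lam * u0) * 1 * ((1 + lam) * Real.sin θ) := by gcongr
      _ = (lam ^ 2 * Real.exp (-lam * u0) + lam * Real.exp (-lam * u0)) * Real.sin θ := by ring
      _ < 2 * a * Real.sin θ := by
        have := hpos h0
        gcongr
        linarith

/-- Away from the saddle point the real part of the phase is bounded away from its maximum. -/
theorem exists_phase_gap {lam a u0 δ : ℝ} (ha : 0 < a) (hlam : -1 < lam)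
    (h : Real.exp u0 + lam * Real.exp (-lam * u0) = 2 * a)
    (hpos : 0 < lam → lam ^ 2 * Real.exp (-lam * u0) < Real.exp u0) (hδ : 0 < δ) :
    ∃ κ, 0 < κ ∧ ∀ τ : ℝ, δ ≤ |τ| →
      (phaseC lam a (u0 + Complex.log (1 + τ * Complex.I)) - phaseC lam a u0).re ≤ -κ := by
  have hanti := strictAntiOn_phaseDecay ha hlam h hpos
  have hδ1 : 0 < Real.arctan δ := Real.arctan_pos.2 hδ
  have hδ2 := Real.arctan_lt_pi_div_two δ
  have hpi := Real.pi_pos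
  refine ⟨-phaseDecay lam a u0 (Real.arctan δ), ?_, fun τ hτ => ?_⟩
  · have := hanti ⟨le_rfl, by linarith⟩ ⟨hδ1.le, hδ2⟩ hδ1
    rw [phaseDecay_zero] at this
    linarith
  · have h1 := re_phase_sub lam a u0 (Real.neg_pi_div_two_lt_arctan τ) (Real.arctan_lt_pi_div_two τ)
    rw [Real.tan_arctan] at h1
    have h2 : phaseDecay lam a u0 (Real.arctan τ) = phaseDecay lam a u0 (Real.arctan |τ|) := by
      rcases abs_choice τ with e | e
      · rw [e]
      · rw [e, Real.arctan_neg, phaseDecay_neg]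
    rw [h1, h2, neg_neg]
    have h3 : Real.arctan δ ≤ Real.arctan |τ| := Real.arctan_strictMono.monotone hτ
    exact hanti.antitoneOn ⟨hδ1.le, hδ2⟩ ⟨hδ1.le.trans h3, Real.arctan_lt_pi_div_two _⟩ h3

/-! ### Assembly of the expansion -/

theorem phaseC_ofReal (lam a u : ℝ) : phaseC lam a u = (phase lam a u : ℂ) := by
  simp [phaseC, phase]

/-- For `t = (x/2) e^u`, the exponent `t + z t^(-λ)` is `(x/2)(e^u - e^(-λu))` and `(x/2)^(ax)
t^(-ax)` is `e^(-axu)`; the extra `t⁻¹`, times `(x/2) e^(u₀)`, leaves `1/(1 + iτ)`. -/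
theorem wrightKernel_scaled {lam a u0 x : ℝ} (hx : 0 < x) (τ : ℝ) :
    (((x / 2) ^ (a * x) * (x / 2 * Real.exp u0) : ℝ) : ℂ) *
      wrightKernel lam (a * x + 1) (-((x / 2) ^ (lam + 1)))
        ((x / 2 * Real.exp u0 : ℝ) + (x / 2 * Real.exp u0 * τ : ℝ) * Complex.I) =
      Real.exp (x * phase lam a u0) * saddleIntegrand lam a u0 x τ := by
  have hx2 : 0 < x / 2 := half_pos hx
  set c := x / 2 * Real.exp u0 with hc
  have hc0 : 0 < c := by positivity
  have hsl := one_add_mul_I_mem_slitPlane τ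
  have hne := Complex.slitPlane_ne_zero hsl
  set l := Complex.log (1 + τ * Complex.I) with hl
  set L := Real.log (x / 2) with hL
  have hexpl : Complex.exp l = 1 + τ * Complex.I := Complex.exp_log hne
  have hxL : (x : ℂ) = 2 * Complex.exp L := by
    rw [hL, ← Complex.ofReal_exp, Real.exp_log hx2]; push_cast; ring
  have ht : ((c : ℂ) + ((c * τ : ℝ) : ℂ) * Complex.I) = c * (1 + τ * Complex.I) := by
    push_cast; ring
  have hct : (c : ℂ) * (1 + τ * Complex.I) = Complex.exp (L + (u0 + l)) := by
    rw [Complex.exp_add, Complex.exp_add, hexpl, hL, ← Complex.ofReal_exp, ← Complex.ofReal_exp,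
      Real.exp_log hx2, hc]
    push_cast; ring
  have hlog : Complex.log (c * (1 + τ * Complex.I)) = L + (u0 + l) := by
    rw [Complex.log_ofReal_mul hc0 hne, hc, Real.log_mul hx2.ne' (Real.exp_pos _).ne', Real.log_exp]
    push_cast; ring
  have hcne : (c : ℂ) * (1 + τ * Complex.I) ≠ 0 :=
    mul_ne_zero (by exact_mod_cast hc0.ne') hne
  have hpow : ∀ s : ℂ, ((c : ℂ) * (1 + τ * Complex.I)) ^ s = Complex.exp ((L + (u0 + l)) * s) :=
    fun s => by rw [Complex.cpow_def_of_ne_zero hcne, hlog]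
  have hrp : ∀ s : ℝ, (((x / 2) ^ s : ℝ) : ℂ) = Complex.exp (L * s) := fun s => by
    rw [Real.rpow_def_of_pos hx2, Complex.ofReal_exp, Complex.ofReal_mul]
  have hcC : (c : ℂ) = Complex.exp (L + u0) := by
    rw [hc, Complex.exp_add, hL, ← Complex.ofReal_exp, ← Complex.ofReal_exp, Real.exp_log hx2]
    push_cast; ring
  rw [ht, wrightKernel, hpow, hpow, hct, Complex.ofReal_neg, hrp, Complex.ofReal_mul, hrp, hcC,
    saddleIntegrand, phaseC_ofReal, ← hl, ← hexpl, div_eq_mul_inv, ← Complex.exp_neg,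
    Complex.ofReal_exp, neg_mul, ← Complex.exp_add, ← Complex.exp_add, ← Complex.exp_add,
    ← Complex.exp_add, ← Complex.exp_add, ← Complex.exp_add]
  congr 1
  have e1 : (L * ((lam + 1 : ℝ) : ℂ) + (L + (u0 + l)) * -(lam : ℂ) : ℂ) =
      L + -(lam : ℂ) * (u0 + l) := by push_cast; ring
  rw [e1, Complex.exp_add, Complex.exp_add (L : ℂ)]
  have e2 : (x : ℂ) * phaseC lam a (u0 + l) = Complex.exp L * Complex.exp (u0 + l) -
      Complex.exp L * Complex.exp (-(lam : ℂ) * (u0 + l)) - a * x * (u0 + l) := by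
    rw [phaseC]
    have : (x : ℂ) / 2 = Complex.exp L := by rw [hxL]; ring
    rw [← this]
    ring
  push_cast
  linear_combination -e2

open MeasureTheory in
theorem wrightMinus_eq_integral {lam a u0 x : ℝ} (hlam : -1 < lam) (hx : 0 < x) (hax : 1 ≤ a * x) :
    Integrable (saddleIntegrand lam a u0 x) ∧
    (wrightMinus lam (a * x) x : ℂ) = (Real.exp (x * phase lam a u0) / (2 * Real.pi) : ℝ) *
      ∫ τ, saddleIntegrand lam a u0 x τ := by
  have hx2 : 0 < x / 2 := half_pos hx
  set c := x / 2 * Real.exp u0 with hc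
  have hc0 : 0 < c := by positivity
  obtain ⟨hint, hW⟩ := wrightKernel_vertical (lam := lam) (mu := a * x + 1)
    (z := -((x / 2) ^ (lam + 1))) hlam (by linarith)
    (neg_nonpos.2 (by positivity)) hc0
  set K : ℝ → ℂ := fun y => wrightKernel lam (a * x + 1) (-((x / 2) ^ (lam + 1)))
    (c + y * Complex.I) with hK
  have hsc : ∀ τ, (((x / 2) ^ (a * x) * c : ℝ) : ℂ) * K (c * τ) =
      Real.exp (x * phase lam a u0) * saddleIntegrand lam a u0 x τ :=
    fun τ => wrightKernel_scaled hx τ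
  have hE : (Real.exp (x * phase lam a u0) : ℂ) ≠ 0 := by
    exact_mod_cast (Real.exp_pos _).ne'
  have hpi : (Real.pi : ℂ) ≠ 0 := by exact_mod_cast Real.pi_ne_zero
  have hc' : (c : ℂ) ≠ 0 := by exact_mod_cast hc0.ne'
  constructor
  · have h1 := ((hint.comp_mul_left' hc0.ne').const_mul (((x / 2) ^ (a * x) * c : ℝ) : ℂ)).const_mul
      (Real.exp (x * phase lam a u0) : ℂ)⁻¹
    refine h1.congr (Eventually.of_forall fun τ => ?_)
    have := hsc τ
    simp only [hK] at this
    simp only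
    rw [this, inv_mul_cancel_left₀ hE]
  · have h1 : (Real.exp (x * phase lam a u0) : ℂ) * ∫ τ, saddleIntegrand lam a u0 x τ =
        (((x / 2) ^ (a * x) * c : ℝ) : ℂ) * ((c : ℂ)⁻¹ * ∫ y, K y) := by
      rw [← integral_const_mul]
      simp only [← hsc]
      rw [integral_const_mul, Measure.integral_comp_mul_left K, abs_of_pos (inv_pos.2 hc0),
        Complex.real_smul, Complex.ofReal_inv]
    rw [Complex.ofReal_div, div_mul_eq_mul_div, h1, ← hW, wrightMinus]
    push_cast
    field_simp

open MeasureTheory in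
theorem tail_isBigO {lam a u0 δ : ℝ} (ha : 0 < a) (hlam : -1 < lam)
    (h : Real.exp u0 + lam * Real.exp (-lam * u0) = 2 * a)
    (hpos : 0 < lam → lam ^ 2 * Real.exp (-lam * u0) < Real.exp u0) (hδ : 0 < δ) (N : ℕ) :
    (fun x : ℝ => (∫ τ, saddleIntegrand lam a u0 x τ) -
      ∫ τ in (-δ)..δ, saddleIntegrand lam a u0 x τ) =O[atTop]
      fun x => Real.sqrt (2 * Real.pi / x) / x ^ N := by
  obtain ⟨κ, hκ, hgap⟩ := exists_phase_gap ha hlam h hpos hδ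
  -- At `x0` the parameter `a x + 1` reaches `2`, so the integrand is integrable. For larger `x` the
  -- gap gives the factor `e^(-κ(x - x0))` relative to this fixed integrand.
  set x0 := 1 / a with hx0
  have hx0pos : 0 < x0 := by positivity
  have hi : ∀ x, x0 ≤ x → Integrable (saddleIntegrand lam a u0 x) := fun x hx =>
    (wrightMinus_eq_integral hlam (hx0pos.trans_le hx) (by
      rw [hx0, div_le_iff₀ ha] at hx; linarith)).1
  refine IsBigO.trans (IsBigO.of_bound (Real.exp (x0 * κ) * ∫ τ, ‖saddleIntegrand lam a u0 x0 τ‖) ?_)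
    (exp_neg_isBigO_gaussian hκ N)
  filter_upwards [eventually_ge_atTop x0] with x hx
  have hcompl := integral_add_compl (s := Set.Ioc (-δ) δ) measurableSet_Ioc (hi x hx)
  rw [intervalIntegral.integral_of_le (by linarith), ← hcompl, add_sub_cancel_left,
    Real.norm_of_nonneg (Real.exp_pos _).le]
  have hpt : ∀ τ ∈ (Set.Ioc (-δ) δ)ᶜ, ‖saddleIntegrand lam a u0 x τ‖ ≤
      Real.exp (x0 * κ) * Real.exp (-κ * x) * ‖saddleIntegrand lam a u0 x0 τ‖ := by
    intro τ hτ
    have hτ' : δ ≤ |τ| := by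
      by_contra! hlt
      exact hτ ⟨(abs_lt.1 hlt).1, (abs_lt.1 hlt).2.le⟩
    have hg := hgap τ hτ'
    simp only [saddleIntegrand, norm_div, Complex.norm_exp, Complex.re_ofReal_mul]
    rw [← mul_div_assoc, ← Real.exp_add, ← Real.exp_add]
    gcongr
    nlinarith
  calc _ ≤ ∫ τ in (Set.Ioc (-δ) δ)ᶜ,
        Real.exp (x0 * κ) * Real.exp (-κ * x) * ‖saddleIntegrand lam a u0 x0 τ‖ := by
        refine norm_integral_le_of_norm_le (((hi x0 le_rfl).norm.const_mul _).integrableOn) ?_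
        filter_upwards [ae_restrict_mem measurableSet_Ioc.compl] with τ hτ
        exact hpt τ hτ
    _ ≤ ∫ τ, Real.exp (x0 * κ) * Real.exp (-κ * x) * ‖saddleIntegrand lam a u0 x0 τ‖ :=
        setIntegral_le_integral ((hi x0 le_rfl).norm.const_mul _)
          (Eventually.of_forall fun τ => by positivity)
    _ = _ := by rw [integral_const_mul]; ring

theorem saddlePrefactor_eq (lam a u0 : ℝ) {x : ℝ} (hx : 0 < x) :
    saddlePrefactor lam a u0 x = Real.exp (x * phase lam a u0) / (2 * Real.pi) *
      (Real.sqrt (2 * Real.pi / x) / Real.sqrt (phaseDeriv lam a u0 2)) := by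
  have hpi := Real.pi_pos
  have h1 : Real.sqrt (2 * Real.pi / x) = 2 * Real.pi / Real.sqrt (2 * Real.pi * x) := by
    rw [show 2 * Real.pi / x = (2 * Real.pi) ^ 2 / (2 * Real.pi * x) by field_simp,
      Real.sqrt_div (by positivity), Real.sqrt_sq (by positivity)]
  rw [saddlePrefactor, Real.sqrt_mul (by positivity), h1]
  field_simp

theorem wrightMinus_expansion {lam a u0 : ℝ} {Ψ S : ℂ → ℂ} (ha : 0 < a) (hlam : -1 < lam)
    (h : Real.exp u0 + lam * Real.exp (-lam * u0) = 2 * a)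
    (hpos : 0 < lam → lam ^ 2 * Real.exp (-lam * u0) < Real.exp u0)
    (h2 : 0 < phaseDeriv lam a u0 2) (hS : IsSaddleReversion lam a u0 Ψ S) (N : ℕ) :
    (fun x : ℝ => wrightMinus lam (a * x) x - saddlePrefactor lam a u0 x *
        ∑ k ∈ Finset.range N, (-1) ^ k * poch (1 / 2) k * reversionCoeff lam a u0 S k / (x / 2) ^ k)
      =O[atTop] fun x : ℝ => saddlePrefactor lam a u0 x / x ^ N := by
  have hm : 0 < Real.sqrt (phaseDeriv lam a u0 2) := Real.sqrt_pos.2 h2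
  obtain ⟨δ, hδ, hloc⟩ := hS.local_expansion h2
  have key := (tail_isBigO ha hlam h hpos hδ N).add (hloc N)
  have key2 := (Complex.isBigO_ofReal_left.2 (isBigO_refl (fun x : ℝ =>
    Real.exp (x * phase lam a u0) / (2 * Real.pi)) atTop)).mul key
  refine (Complex.isBigO_ofReal_left.1 (key2.congr' ?_ EventuallyEq.rfl)).trans ?_
  · filter_upwards [eventually_gt_atTop 0, eventually_ge_atTop (1 / a)] with x hx hax
    rw [Complex.ofReal_sub, (wrightMinus_eq_integral hlam hx
      (by rwa [div_le_iff₀' ha] at hax)).2, saddlePrefactor_eq lam a u0 hx, mul_assoc,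
      Complex.ofReal_mul, sub_add_sub_cancel, ← mul_sub, Finset.mul_sum]
    congr 3
    refine Finset.sum_congr rfl fun k _ => ?_
    ring
  -- The error scale of the integral is the prefactor's up to the constant `√h₀''`.
  · refine IsBigO.of_bound (Real.sqrt (phaseDeriv lam a u0 2)) ?_
    filter_upwards [eventually_gt_atTop 0] with x hx
    nth_rw 1 [← Real.norm_of_nonneg hm.le]
    rw [saddlePrefactor_eq lam a u0 hx, ← norm_mul]
    refine le_of_eq (congrArg _ ?_)
    field_simp

end

theorem mainTheorem1 (lam a : ℝ) (ha : 0 < a)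
    (hlam : (-1 < lam ∧ lam < 0) ∨
      (0 < lam ∧ (1 / 2 : ℝ) * (1 + lam) * lam ^ ((1 - lam) / (1 + lam)) < a)) :
    -- the series defining the Wright function converges
    (∀ mu z : ℝ, Summable fun n : ℕ =>
      z ^ n / ((n.factorial : ℝ) * Real.Gamma (lam * n + mu))) ∧
    -- `u0` is the only real saddle for `lam < 0` and the larger of exactly two for `lam > 0`
    ∃ u0 : ℝ, IsGreatest (realSaddles lam a) u0 ∧
      (lam < 0 → realSaddles lam a = {u0}) ∧
      (0 < lam → (realSaddles lam a).ncard = 2) ∧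
      0 < phaseDeriv lam a u0 2 ∧
      (∀ n : ℕ, 2 ≤ n → phaseDeriv lam a u0 n =
        (1 - (-lam) ^ (n - 1)) * Real.exp u0 / 2 + a * (-lam) ^ (n - 1)) ∧
      ∃ A : ℕ → ℝ, IsReversionCoeffs lam a u0 A ∧
        A 0 = 1 ∧
        (∀ h2 h3 h4 h5 h6 h7 h8 : ℝ,
          h2 = phaseDeriv lam a u0 2 →
          h3 = phaseRatio lam a u0 3 → h4 = phaseRatio lam a u0 4 →
          h5 = phaseRatio lam a u0 5 → h6 = phaseRatio lam a u0 6 →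
          h7 = phaseRatio lam a u0 7 → h8 = phaseRatio lam a u0 8 →
          A 1 = (5 * h3 ^ 2 - 3 * h4) / (24 * h2) ∧
          A 2 = (385 * h3 ^ 4 - 630 * h3 ^ 2 * h4 + 105 * h4 ^ 2 + 168 * h3 * h5 - 24 * h6)
            / (3456 * h2 ^ 2) ∧
          A 3 = (425425 * h3 ^ 6 - 1126125 * h3 ^ 4 * h4 + 675675 * h3 ^ 2 * h4 ^ 2
              - 51975 * h4 ^ 3 + 360360 * h3 ^ 3 * h5 - 249480 * h3 * h4 * h5
              + 13608 * h5 ^ 2 - 83160 * h3 ^ 2 * h6 + 22680 * h4 * h6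
              + 12960 * h3 * h7 - 1080 * h8) / (6220800 * h2 ^ 3)) ∧
        -- the asymptotic expansion to every order `N`
        ∀ N : ℕ,
          (fun x : ℝ => wrightMinus lam (a * x) x - saddlePrefactor lam a u0 x *
              ∑ k ∈ Finset.range N, (-1) ^ k * poch (1 / 2) k * A k / (x / 2) ^ k)
            =O[atTop] fun x : ℝ => saddlePrefactor lam a u0 x / x ^ N
 := by
  have hlam1 : -1 < lam := by rcases hlam with h | h <;> linarith [h.1]
  have hlam0 : lam ≠ 0 := by
    rcases hlam with h | h
    exacts [h.2.ne, h.1.ne']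
  refine ⟨summable_wright hlam1, ?_⟩
  obtain ⟨u0, hgr, hneg, hcard, hpos⟩ : ∃ u0, IsGreatest (realSaddles lam a) u0 ∧
      (lam < 0 → realSaddles lam a = {u0}) ∧ (0 < lam → (realSaddles lam a).ncard = 2) ∧
      (0 < lam → lam ^ 2 * Real.exp (-lam * u0) < Real.exp u0) := by
    rcases hlam with ⟨h1, h2⟩ | ⟨h1, h2⟩
    · obtain ⟨u0, hu⟩ := realSaddles_of_neg ha h1 h2
      exact ⟨u0, hu ▸ isGreatest_singleton, fun _ => hu, fun h => absurd h h2.not_gt,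
        fun h => absurd h h2.not_gt⟩
    · obtain ⟨u1, u0, hlt, hu, hp⟩ := realSaddles_of_pos h1 h2
      refine ⟨u0, ?_, fun h => absurd h h1.not_gt, fun _ => hu ▸ Set.ncard_pair hlt.ne,
        fun _ => hp⟩
      rw [hu]
      simpa [hlt.le] using isGreatest_pair (a := u1) (b := u0)
  have h : Real.exp u0 + lam * Real.exp (-lam * u0) = 2 * a := hgr.1
  have h2 := phaseDeriv_two_pos ha hlam1 hlam0 h hpos
  obtain ⟨Ψ, S, hS⟩ := exists_isSaddleReversion h h2
  refine ⟨u0, hgr, hneg, hcard, h2, fun n hn => phaseDeriv_eq h hn, reversionCoeff lam a u0 S,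
    hS.isReversionCoeffs h2, hS.reversionCoeff_zero, ?_,
    wrightMinus_expansion ha hlam1 h hpos h2 hS⟩
  intro k2 k3 k4 k5 k6 k7 k8 e2 e3 e4 e5 e6 e7 e8
  exact hS.reversionCoeff_eq h (e2 ▸ h2) e2 e3 e4 e5 e6 e7 e8
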